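/- Let $1\le N_T\le N_R$ be integers, $N=N_R-N_T+1$, and $\Gamma_1>0$. Let $A_n(\sigma)=\frac{(N)_n}{(N_R)_n}\frac{\sigma^n}{n!}$ with $(k)_n=k(k+1)\cdots(k+n-1)$, and let ${}_1F_1(N;N_R;\sigma)=\sum_{n\ge 0}A_n(\sigma)$ be the confluent hypergeometric function. The zero-forcing (ZF) SNR $\gamma_1$ under Rician--Rayleigh fading has, for $a\ge 0$, the moment generating function $$M_{\gamma_1}(s,a)=\frac{1}{(1-\Gamma_1 s)^{N}}\;{}_1F_1\!\Big(N;N_R;\frac{a\,\Gamma_1 s}{1-\Gamma_1 s}\Big),\qquad s<1/\Gamma_1 ,$$ and we put $$p_{\gamma_1}(t,a)=\sum_{n=0}^{\infty}A_n(a)\sum_{m=0}^{n}\binom nm\frac{(-1)^m\,t^{N+n-m-1}e^{-t/\Gamma_1}}{(N+n-m-1)!\;\Gamma_1^{N+n-m}} .$$ Call a function $f(x,y)$ on a set $D$ holonomic with respect to $x$ if there are $r\ge 0$ and polynomials $c_0,\dots,c_r$ in $(x,y)$ such that, at every point of $D$, $f$ is $r$ times continuously differentiable in $x$ with $\sum_{i=0}^{r}c_i(x,y)\,\partial_x^i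 f(x,y)=0$, and such that for every $y$ occurring in $D$ the polynomial $c_r(\cdot,y)$ is not identically zero; holonomic with respect to $y$ is defined in the same way with the variables exchanged. Then, both over $\mathbb R$ and over $\mathbb C$: 1. $M_{\gamma_1}(s,a)$, given by the formula above for all $(s,a)$ with $\Gamma_1 s\ne 1$, is holonomic with respect to both $s$ and $a$. 2. $p_{\gamma_1}(t,a)$ is holonomic with respect to both $t$ and $a$, on all $(t,a)$. Moreover, $p_{\gamma_1}(\cdot,a)$ is indeed the p.d.f. that belongs to this m.g.f.: for every real $a\ge 0$ one has $p_{\gamma_1}(t,a)\ge 0$ for $t>0$, and a measure $\mu$ on $\mathbb R$ is a probability measure with $\int e^{st}\,\mathrm d\mu(t)=M_{\gamma_1}(s,a)$ (integrable) for all real $s<1/\Gamma_1$ if and only if $\mu$ has the density $p_{\gamma_1}(t,a)$ on $(0,\infty)$ and no mass elsewhere. -/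

import Mathlib

open MeasureTheory ProbabilityTheory

/-- The function `f (x, y)` is holonomic with respect to its first variable on `D`: there is a
single linear differential equation in `x`, with coefficients polynomial in `x` and `y`, that holds
at every point of `D`, and for every `y` that occurs in `D` its leading coefficient is not the zero
polynomial in `x`. The derivatives involved are required to exist. -/
def IsHolonomicFst {𝕜 : Type*} [NontriviallyNormedField 𝕜] (f : 𝕜 → 𝕜 → 𝕜) (D : Set (𝕜 × 𝕜)) :
    Prop :=
  ∃ (r : ℕ) (c : ℕ → MvPolynomial (Fin 2) 𝕜), ∀ x y : 𝕜, (x, y) ∈ D →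
    (∃ x' : 𝕜, MvPolynomial.eval ![x', y] (c r) ≠ 0) ∧
    ContDiffAt 𝕜 r (fun x' => f x' y) x ∧
    ∑ i ∈ Finset.range (r + 1),
      MvPolynomial.eval ![x, y] (c i) * iteratedDeriv i (fun x' => f x' y) x = 0

/-- Holonomic on `D` with respect to each of the two variables. -/
def IsHolonomic {𝕜 : Type*} [NontriviallyNormedField 𝕜] (f : 𝕜 → 𝕜 → 𝕜) (D : Set (𝕜 × 𝕜)) :
    Prop :=
  IsHolonomicFst f D ∧ IsHolonomicFst (fun y x => f x y) (Prod.swap ⁻¹' D)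

/-- The term `A_n(σ) = (N)_n / (N_R)_n * σ ^ n / n!` of the confluent hypergeometric series;
`k.ascFactorial n` is the Pochhammer symbol `(k)_n = k (k + 1) ⋯ (k + n - 1)`. -/
noncomputable def kummerTerm {𝕜 : Type*} [NontriviallyNormedField 𝕜] (N NR n : ℕ) (σ : 𝕜) : 𝕜 :=
  (N.ascFactorial n : 𝕜) / (NR.ascFactorial n : 𝕜) * (σ ^ n / (n.factorial : 𝕜))

/-- The confluent hypergeometric function `₁F₁(N; N_R; σ)`. -/
noncomputable def kummer {𝕜 : Type*} [NontriviallyNormedField 𝕜] (N NR : ℕ) (σ : 𝕜) : 𝕜 :=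
  ∑' n : ℕ, kummerTerm N NR n σ

/-- The moment generating function `M_{γ₁}(s, a)` of the zero-forcing SNR. -/
noncomputable def zfMgf {𝕜 : Type*} [NontriviallyNormedField 𝕜] (N NR : ℕ) (Γ₁ s a : 𝕜) : 𝕜 :=
  1 / (1 - Γ₁ * s) ^ N * kummer N NR (a * (Γ₁ * s / (1 - Γ₁ * s)))

/-- The (everywhere convergent) series for the probability density `p_{γ₁}(t, a)`, `t > 0`, of the
zero-forcing SNR. -/
noncomputable def zfPdf {𝕜 : Type*} [RCLike 𝕜] (N NR : ℕ) (Γ₁ t a : 𝕜) : 𝕜 :=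
  ∑' n : ℕ, kummerTerm N NR n a * ∑ m ∈ Finset.range (n + 1),
    (n.choose m : 𝕜) * ((-1) ^ m * t ^ (N + n - m - 1) * NormedSpace.exp (-t / Γ₁) /
      (((N + n - m - 1).factorial : 𝕜) * Γ₁ ^ (N + n - m)))

/-- `μ` is a law of the zero-forcing SNR: a probability distribution whose moment generating
function exists for `s < 1 / Γ₁` and equals `M_{γ₁}(s, a)` there. -/
def IsZfSnrLaw (N NR : ℕ) (Γ₁ a : ℝ) (μ : Measure ℝ) : Prop :=
  IsProbabilityMeasure μ ∧ ∀ s : ℝ, s < 1 / Γ₁ →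
    Integrable (fun t => Real.exp (s * t)) μ ∧ mgf id μ s = zfMgf N NR Γ₁ s a

/-!
For fixed `s`, the moment generating function is an entire power series in `a`, and for fixed `a` it
is `(1 - Γ s)⁻ᴺ F(Γ s / (1 - Γ s))` with `F(u) = ₁F₁(N; N_R; a u)`; in both variables Kummer's
equation becomes an equation with polynomial coefficients.

Write `e_n` for the Erlang density with `n + 1` phases, whose moment generating function is
`(1 - Γ s)^(-(n + 1))`. The `n`-th term of the density is `A_n(a)` times the `n`-th forward
difference of `k ↦ e_k(t)` at `k = N - 1`. Differencing once multiplies the moment generating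
function by `1 / (1 - Γ s) - 1 = Γ s / (1 - Γ s)`, so the moment generating functions of the terms
sum up to `M(s, a)`. The relation `(k + 1) e_{k+1} = (t / Γ) e_k` gives a three-term recurrence for
these differences, hence a recurrence for the coefficients of the density as a power series in `a`,
which is a differential equation in `a`.

Collecting the multiples of each Erlang density instead yields
`p(t, a) = ∑ₖ e_{N-1+k}(t) A_k(a) ₁F₁(N + k; N_R + k; -a)`. Kummer's transformation
`₁F₁(p; p + q; -a) = e^{-a} ₁F₁(q; p + q; a)` shows that all terms are nonnegative, and the
contiguous relation between neighbouring `₁F₁` factors is a differential equation in `t`.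

A law with this moment generating function is unique because the function is finite on a
neighbourhood of `0`, so it determines the characteristic function by analytic continuation.
-/

/-! ### Entire power series -/

section EntireSeries

open PowerSeries Finset.HasAntidiagonal

theorem derivative_C_mul {R : Type*} [CommSemiring R] (c : R) (F : R⟦X⟧) :
    d⁄dX R (C c * F) = C c * d⁄dX R F := by
  rw [← smul_eq_C_mul, Derivation.map_smul, smul_eq_C_mul]

theorem rescale_C {R : Type*} [CommSemiring R] (r c : R) : rescale r (C c) = C c := by
  ext n
  cases n <;> simp [coeff_rescale, coeff_C]

theorem constantCoeff_rescale {R : Type*} [CommSemiring R] (u : R) (F : R⟦X⟧) :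
    constantCoeff (rescale u F) = constantCoeff F := by
  simp only [← coeff_zero_eq_constantCoeff_apply, coeff_rescale, pow_zero, one_mul]

theorem derivative_rescale {R : Type*} [CommSemiring R] (u : R) (F : R⟦X⟧) :
    d⁄dX R (rescale u F) = C u * rescale u (d⁄dX R F) := by
  ext n
  simp only [coeff_derivative, coeff_rescale, coeff_C_mul]
  ring

theorem coeff_X_mul_derivative {R : Type*} [CommSemiring R] (F : R⟦X⟧) (n : ℕ) :
    coeff n (X * d⁄dX R F) = n * coeff n F := by
  cases n with
  | zero => simp
  | succ n => rw [coeff_succ_X_mul, coeff_derivative, Nat.cast_succ, mul_comm]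

theorem X_mul_derivative_X_pow {R : Type*} [CommSemiring R] (m : ℕ) :
    (X : R⟦X⟧) * d⁄dX R (X ^ m) = C (m : R) * X ^ m := by
  cases m with
  | zero => simp
  | succ n =>
    rw [Derivation.leibniz_pow, derivative_X, Nat.add_sub_cancel, smul_eq_mul, mul_one,
      nsmul_eq_mul, map_natCast]
    ring

theorem X_mul_derivative_derivative {R : Type*} [CommRing R] {c : R} {F : R⟦X⟧}
    (h : X * d⁄dX R F = C c * F) : X * d⁄dX R (d⁄dX R F) = C (c - 1) * d⁄dX R F := by
  have h' := congrArg (d⁄dX R) h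
  rw [derivative_C_mul, Derivation.leibniz, derivative_X, smul_eq_mul, smul_eq_mul] at h'
  rw [map_sub, map_one]
  linear_combination h'

variable {𝕜 : Type*} [RCLike 𝕜]

/-- The sum of the formal power series `F` at the point `x`, with value `0` where it diverges. -/
noncomputable def seriesSum (F : 𝕜⟦X⟧) (x : 𝕜) : 𝕜 := ∑' n, coeff n F * x ^ n

theorem coeff_mul_mul_pow (F G : 𝕜⟦X⟧) (x : 𝕜) (n : ℕ) :
    coeff n (F * G) * x ^ n =
      ∑ p ∈ antidiagonal n, coeff p.1 F * x ^ p.1 * (coeff p.2 G * x ^ p.2) := by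
  rw [coeff_mul, Finset.sum_mul]
  refine Finset.sum_congr rfl fun p hp => ?_
  rw [← mem_antidiagonal.1 hp, pow_add]
  ring

variable (𝕜) in
/-- The algebra of formal power series that converge absolutely on all of `𝕜`. -/
def entireSeries : Subalgebra 𝕜 𝕜⟦X⟧ where
  carrier := {F | ∀ x : 𝕜, Summable fun n => ‖coeff n F * x ^ n‖}
  add_mem' {F G} hF hG x :=
    .of_nonneg_of_le (fun _ => norm_nonneg _)
      (fun n => by rw [map_add, add_mul]; exact norm_add_le _ _) ((hF x).add (hG x))
  mul_mem' {F G} hF hG x := by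
    simp only [coeff_mul_mul_pow]
    exact summable_norm_sum_mul_antidiagonal_of_summable_norm
      (f := fun n => coeff n F * x ^ n) (g := fun n => coeff n G * x ^ n) (hF x) (hG x)
  algebraMap_mem' c x := summable_of_ne_finset_zero (s := {0}) fun n hn => by
    rw [PowerSeries.algebraMap_apply, coeff_C, if_neg (by simpa using hn), zero_mul, norm_zero]

variable {F G : 𝕜⟦X⟧}

theorem mem_entireSeries_of_norm_coeff_le {B R : ℝ}
    (h : ∀ n, ‖coeff n F‖ ≤ B * (R ^ n / n.factorial)) : F ∈ entireSeries 𝕜 := fun x => by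
  refine .of_nonneg_of_le (fun _ => norm_nonneg _) (fun n => ?_)
    ((Real.summable_pow_div_factorial (R * ‖x‖)).mul_left B)
  calc ‖coeff n F * x ^ n‖ = ‖coeff n F‖ * ‖x‖ ^ n := by rw [norm_mul, norm_pow]
    _ ≤ B * (R ^ n / n.factorial) * ‖x‖ ^ n := by gcongr; exact h n
    _ = B * ((R * ‖x‖) ^ n / n.factorial) := by ring

theorem C_mem_entireSeries (c : 𝕜) : C c ∈ entireSeries 𝕜 :=
  (entireSeries 𝕜).algebraMap_mem c

theorem X_mem_entireSeries : (X : 𝕜⟦X⟧) ∈ entireSeries 𝕜 := fun x =>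
  summable_of_ne_finset_zero (s := {1}) fun n hn => by
    rw [coeff_X, if_neg (by simpa using hn), zero_mul, norm_zero]

theorem rescale_mem_entireSeries (hF : F ∈ entireSeries 𝕜) (u : 𝕜) :
    rescale u F ∈ entireSeries 𝕜 := fun x =>
  (hF (u * x)).congr fun n => by rw [coeff_rescale, mul_pow]; congr 1; ring

theorem exp_mem_entireSeries : exp 𝕜 ∈ entireSeries 𝕜 :=
  mem_entireSeries_of_norm_coeff_le (B := 1) (R := 1) fun n => by simp [coeff_exp]

theorem seriesSum_C (c x : 𝕜) : seriesSum (C c) x = c := by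
  rw [seriesSum, tsum_eq_single 0 fun n hn => by rw [coeff_C, if_neg hn, zero_mul]]
  simp

theorem seriesSum_X (x : 𝕜) : seriesSum X x = x := by
  rw [seriesSum, tsum_eq_single 1 fun n hn => by rw [coeff_X, if_neg hn, zero_mul]]
  simp

theorem seriesSum_C_mul (c : 𝕜) (F : 𝕜⟦X⟧) (x : 𝕜) :
    seriesSum (C c * F) x = c * seriesSum F x := by
  simp only [seriesSum, coeff_C_mul, mul_assoc, tsum_mul_left]

theorem seriesSum_rescale (F : 𝕜⟦X⟧) (u x : 𝕜) :
    seriesSum (rescale u F) x = seriesSum F (u * x) :=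
  tsum_congr fun n => by rw [coeff_rescale, mul_pow]; ring

theorem seriesSum_exp (x : 𝕜) : seriesSum (exp 𝕜) x = NormedSpace.exp x := by
  rw [seriesSum, NormedSpace.exp_eq_tsum_div]
  exact tsum_congr fun n => by simp [coeff_exp, div_eq_inv_mul]

theorem seriesSum_add (hF : F ∈ entireSeries 𝕜) (hG : G ∈ entireSeries 𝕜) (x : 𝕜) :
    seriesSum (F + G) x = seriesSum F x + seriesSum G x := by
  simp only [seriesSum, map_add, add_mul]
  exact (hF x).of_norm.tsum_add (hG x).of_norm

theorem seriesSum_mul (hF : F ∈ entireSeries 𝕜) (hG : G ∈ entireSeries 𝕜) (x : 𝕜) :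
    seriesSum (F * G) x = seriesSum F x * seriesSum G x := by
  simp only [seriesSum, coeff_mul_mul_pow]
  exact (tsum_mul_tsum_eq_tsum_sum_antidiagonal_of_summable_norm (hF x) (hG x)).symm

/-- Evaluation at the point `x`, as an algebra homomorphism on the entire power series. -/
noncomputable def entireEval (x : 𝕜) : entireSeries 𝕜 →ₐ[𝕜] 𝕜 where
  toFun F := seriesSum F.1 x
  map_one' := seriesSum_C 1 x
  map_zero' := (congrArg (seriesSum · x) (map_zero C).symm).trans (seriesSum_C 0 x)
  map_mul' F G := seriesSum_mul F.2 G.2 x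
  map_add' F G := seriesSum_add F.2 G.2 x
  commutes' c := seriesSum_C c x

theorem entireEval_apply (x : 𝕜) (F : entireSeries 𝕜) : entireEval x F = seriesSum F.1 x :=
  rfl

theorem norm_mul_natCast_mul_pow_le {x : 𝕜} {ρ : ℝ} (hρ : 1 ≤ ρ) (hx : ‖x‖ ≤ ρ) (c : 𝕜) (n : ℕ) :
    ‖c * (n * x ^ (n - 1))‖ ≤ ‖c * ((2 * ρ : ℝ) : 𝕜) ^ n‖ := by
  have hn : (n : ℝ) ≤ 2 ^ n := mod_cast n.lt_two_pow_self.le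
  have hpow : ‖x‖ ^ (n - 1) ≤ ρ ^ n :=
    (pow_le_pow_left₀ (norm_nonneg x) hx _).trans (pow_le_pow_right₀ hρ n.pred_le)
  simp only [norm_mul, norm_pow, RCLike.norm_natCast, RCLike.norm_ofReal,
    abs_of_nonneg (by positivity : 0 ≤ 2 * ρ), mul_pow]
  gcongr

theorem derivative_mem_entireSeries (hF : F ∈ entireSeries 𝕜) : d⁄dX 𝕜 F ∈ entireSeries 𝕜 :=
  fun x => by
    refine .of_nonneg_of_le (fun _ => norm_nonneg _) (fun n => ?_)
      ((summable_nat_add_iff 1).2 (hF ((2 * (‖x‖ + 1) : ℝ) : 𝕜)))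
    refine Eq.trans_le ?_ (norm_mul_natCast_mul_pow_le (x := x) (by simp) (by simp) _ (n + 1))
    rw [coeff_derivative, Nat.add_sub_cancel, mul_assoc, Nat.cast_succ]

theorem iterate_derivative_mem_entireSeries (hF : F ∈ entireSeries 𝕜) (i : ℕ) :
    (d⁄dX 𝕜)^[i] F ∈ entireSeries 𝕜 :=
  Function.Iterate.rec (· ∈ entireSeries 𝕜) hF (fun _ => derivative_mem_entireSeries) i

theorem hasDerivAt_seriesSum (hF : F ∈ entireSeries 𝕜) (x : 𝕜) :
    HasDerivAt (seriesSum F) (seriesSum (d⁄dX 𝕜 F) x) x := by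
  have hball : x ∈ Metric.ball (0 : 𝕜) (‖x‖ + 1) := by simp
  have hderiv : ∀ n : ℕ, coeff n (d⁄dX 𝕜 F) * x ^ n =
      coeff (n + 1) F * ((n + 1 : ℕ) * x ^ (n + 1 - 1)) := fun n => by
    rw [coeff_derivative, Nat.add_sub_cancel, mul_assoc, Nat.cast_succ]
  have hsum : seriesSum (d⁄dX 𝕜 F) x = ∑' n, coeff n F * (n * x ^ (n - 1)) := by
    rw [tsum_eq_zero_add' ((derivative_mem_entireSeries hF x).of_norm.congr hderiv)]
    simp only [seriesSum, hderiv, Nat.cast_zero, zero_mul, mul_zero, zero_add]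
  rw [hsum]
  exact hasDerivAt_tsum_of_isPreconnected (hF ((2 * (‖x‖ + 1) : ℝ) : 𝕜)) Metric.isOpen_ball
    (convex_ball (0 : 𝕜) (‖x‖ + 1)).isPreconnected
    (fun n y _ => (hasDerivAt_pow n y).const_mul _)
    (fun n y hy => norm_mul_natCast_mul_pow_le (by simp) (mem_ball_zero_iff.1 hy).le _ n)
    hball (hF x).of_norm hball

theorem deriv_seriesSum (hF : F ∈ entireSeries 𝕜) :
    deriv (seriesSum F) = seriesSum (d⁄dX 𝕜 F) :=
  funext fun x => (hasDerivAt_seriesSum hF x).deriv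

theorem contDiff_seriesSum (hF : F ∈ entireSeries 𝕜) (n : ℕ) : ContDiff 𝕜 n (seriesSum F) := by
  induction n generalizing F with
  | zero =>
    exact contDiff_zero.2
      (continuous_iff_continuousAt.2 fun x => (hasDerivAt_seriesSum hF x).continuousAt)
  | succ n ih =>
    rw [Nat.cast_succ, contDiff_succ_iff_deriv, deriv_seriesSum hF]
    exact ⟨fun x => (hasDerivAt_seriesSum hF x).differentiableAt, by simp,
      ih (derivative_mem_entireSeries hF)⟩

theorem iteratedDeriv_seriesSum (hF : F ∈ entireSeries 𝕜) (i : ℕ) :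
    iteratedDeriv i (seriesSum F) = seriesSum ((d⁄dX 𝕜)^[i] F) := by
  induction i generalizing F with
  | zero => exact iteratedDeriv_zero
  | succ i ih =>
    rw [iteratedDeriv_succ', deriv_seriesSum hF, ih (derivative_mem_entireSeries hF),
      Function.iterate_succ_apply]

theorem IsHolonomicFst.of_powerSeries {f : 𝕜 → 𝕜 → 𝕜} {D : Set (𝕜 × 𝕜)} (r : ℕ)
    (c : ℕ → MvPolynomial (Fin 2) 𝕜) (F : 𝕜 → 𝕜⟦X⟧)
    (hlead : ∀ x y, (x, y) ∈ D → ∃ x', MvPolynomial.eval ![x', y] (c r) ≠ 0)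
    (hF : ∀ x y, (x, y) ∈ D → F y ∈ entireSeries 𝕜)
    (hf : ∀ x y, (x, y) ∈ D → ∀ x', f x' y = seriesSum (F y) x')
    (hode : ∀ x y, (x, y) ∈ D →
      ∑ i ∈ Finset.range (r + 1), MvPolynomial.aeval ![X, C y] (c i) * (d⁄dX 𝕜)^[i] (F y) = 0) :
    IsHolonomicFst f D := by
  refine ⟨r, c, fun x y hxy => ⟨hlead x y hxy, ?_⟩⟩
  have hF := hF x y hxy
  rw [funext (hf x y hxy)]
  refine ⟨(contDiff_seriesSum hF r).contDiffAt, ?_⟩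
  -- Evaluation at `x` is multiplicative only on convergent series, so the equation is lifted there.
  let XY : Fin 2 → entireSeries 𝕜 := ![⟨X, X_mem_entireSeries⟩, ⟨C y, C_mem_entireSeries y⟩]
  have hcoe : (fun j => (XY j : 𝕜⟦X⟧)) = ![X, C y] := by ext1 j; fin_cases j <;> rfl
  have heval : (fun j => entireEval x (XY j)) = ![x, y] := by
    ext1 j
    fin_cases j
    exacts [seriesSum_X x, seriesSum_C y x]
  have hzero : ∑ i ∈ Finset.range (r + 1), MvPolynomial.aeval XY (c i) *
      (⟨(d⁄dX 𝕜)^[i] (F y), iterate_derivative_mem_entireSeries hF i⟩ : entireSeries 𝕜) = 0 := by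
    refine Subtype.ext ?_
    rw [ZeroMemClass.coe_zero, ← hode x y hxy, ← hcoe]
    simp only [Subalgebra.mvPolynomial_aeval_coe, AddSubmonoidClass.coe_finsetSum,
      MulMemClass.coe_mul]
  rw [← map_zero (entireEval x), ← hzero, map_sum]
  refine Finset.sum_congr rfl fun i _ => ?_
  rw [map_mul, iteratedDeriv_seriesSum hF, ← heval, ← MvPolynomial.aeval_eq_eval]
  exact congrArg (· * _) (MvPolynomial.comp_aeval_apply XY (entireEval x) (c i)).symm

end EntireSeries

/-! ### Finite differences -/

section FiniteDifferences

open fwdDiff Finset.HasAntidiagonal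

theorem fwdDiff_iter_succ_apply {G : Type*} [AddCommGroup G] (x : ℕ → G) (n k : ℕ) :
    (Δ_[1])^[n + 1] x k = (Δ_[1])^[n] x (k + 1) - (Δ_[1])^[n] x k := by
  rw [Function.iterate_succ_apply', fwdDiff]

theorem fwdDiff_iter_eq_sum_antidiagonal {R : Type*} [CommRing R] (x : ℕ → R) (n k : ℕ) :
    (Δ_[1])^[n] x k =
      ∑ p ∈ antidiagonal n, (n.choose p.1 : R) * (-1) ^ p.1 * x (k + p.2) := by
  rw [fwdDiff_iter_eq_sum_shift, Finset.Nat.sum_antidiagonal_eq_sum_range_succ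
    (fun i j => (n.choose i : R) * (-1) ^ i * x (k + j)), ← Finset.sum_range_reflect]
  refine Finset.sum_congr rfl fun i hi => ?_
  have hi : i ≤ n := Finset.mem_range_succ_iff.1 hi
  rw [Nat.add_sub_cancel, Nat.choose_symm hi, Nat.sub_sub_self hi, smul_eq_mul, mul_one,
    zsmul_eq_mul]
  push_cast
  ring

theorem norm_fwdDiff_iter_le {E : Type*} [SeminormedAddCommGroup E] {x : ℕ → E} {B : ℝ}
    (hB : ∀ k, ‖x k‖ ≤ B) (n k : ℕ) : ‖(Δ_[1])^[n] x k‖ ≤ B * 2 ^ n := by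
  induction n generalizing k with
  | zero => simpa using hB k
  | succ n ih =>
    rw [fwdDiff_iter_succ_apply]
    linarith [norm_sub_le ((Δ_[1])^[n] x (k + 1)) ((Δ_[1])^[n] x k), ih k, ih (k + 1),
      show B * 2 ^ (n + 1) = B * 2 ^ n + B * 2 ^ n by ring]

theorem fwdDiff_iter_shift_of_recurrence {R : Type*} [CommRing R] {τ : R} {x : ℕ → R}
    (hx : ∀ k : ℕ, (k + 1) * x (k + 1) = τ * x k) (n k : ℕ) :
    (k + n + 2) * (Δ_[1])^[n + 1] x (k + 1) + (n + 1) * (Δ_[1])^[n] x (k + 1) =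
      τ * (Δ_[1])^[n + 1] x k := by
  induction n generalizing k with
  | zero =>
    have hk := hx k
    have hk_succ := hx (k + 1)
    simp only [fwdDiff_iter_succ_apply, Function.iterate_zero_apply]
    push_cast at hk_succ ⊢
    linear_combination hk_succ - hk
  | succ n ih =>
    have hk := ih k
    have hk_succ := ih (k + 1)
    rw [fwdDiff_iter_succ_apply x (n + 1) k, fwdDiff_iter_succ_apply x (n + 1) (k + 1)]
    rw [fwdDiff_iter_succ_apply x n (k + 1 + 1), fwdDiff_iter_succ_apply x n (k + 1)] at *
    push_cast at hk_succ ⊢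
    linear_combination hk_succ - hk

theorem fwdDiff_iter_recurrence {R : Type*} [CommRing R] {τ : R} {x : ℕ → R}
    (hx : ∀ k : ℕ, (k + 1) * x (k + 1) = τ * x k) (n k : ℕ) :
    (k + n + 1) * (Δ_[1])^[n + 1] x k + (k + 1 + 2 * n - τ) * (Δ_[1])^[n] x k +
      n * (Δ_[1])^[n - 1] x k = 0 := by
  cases n with
  | zero =>
    simp only [fwdDiff_iter_succ_apply, Function.iterate_zero_apply]
    push_cast
    linear_combination hx k
  | succ n =>
    have hshift := fwdDiff_iter_shift_of_recurrence hx n k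
    have hn := fwdDiff_iter_succ_apply x n k
    have hn_succ := fwdDiff_iter_succ_apply x (n + 1) k
    rw [Nat.add_sub_cancel]
    push_cast
    linear_combination hshift + (k + n + 2) * hn_succ + (n + 1) * hn

end FiniteDifferences

/-! ### Measures with the same moment generating function -/

section MomentGeneratingFunction

open Filter Topology in
theorem eqOn_complexMGF_of_eventuallyEq_mgf {μ ν : Measure ℝ} {U : Set ℝ} (hU : IsOpen U)
    (hconv : Convex ℝ U) (hμ : U ⊆ integrableExpSet id μ) (hν : U ⊆ integrableExpSet id ν)
    {x₀ : ℝ} (hx₀ : x₀ ∈ U) (h : mgf id μ =ᶠ[𝓝 x₀] mgf id ν) :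
    Set.EqOn (complexMGF id μ) (complexMGF id ν) {z | z.re ∈ U} := by
  refine AnalyticOnNhd.eqOn_of_preconnected_of_frequently_eq (z₀ := (x₀ : ℂ))
    (fun z hz => analyticAt_complexMGF (interior_maximal hμ hU hz))
    (fun z hz => analyticAt_complexMGF (interior_maximal hν hU hz))
    (hconv.linear_preimage Complex.reLm).isPreconnected (by simpa using hx₀) ?_
  have hreal : ∀ᶠ x : ℝ in 𝓝[≠] x₀, complexMGF id μ x = complexMGF id ν x := by
    filter_upwards [h.filter_mono nhdsWithin_le_nhds] with x hx
    rw [complexMGF_ofReal, complexMGF_ofReal, hx]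
  have htendsto : Tendsto ((↑) : ℝ → ℂ) (𝓝[≠] x₀) (𝓝[≠] (x₀ : ℂ)) :=
    Complex.continuous_ofReal.continuousWithinAt.tendsto_nhdsWithin fun x hx => by simpa using hx
  exact htendsto.frequently hreal.frequently

theorem measure_eq_of_eqOn_mgf {μ ν : Measure ℝ} [IsFiniteMeasure μ] [IsFiniteMeasure ν] {U : Set ℝ}
    (hU : IsOpen U) (h0 : 0 ∈ U) (hconv : Convex ℝ U) (hμ : U ⊆ integrableExpSet id μ)
    (hν : U ⊆ integrableExpSet id ν) (h : Set.EqOn (mgf id μ) (mgf id ν) U) : μ = ν := by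
  have hstrip := eqOn_complexMGF_of_eventuallyEq_mgf hU hconv hμ hν h0
    (h.eventuallyEq_of_mem (hU.mem_nhds h0))
  refine Measure.ext_of_charFun (funext fun t => ?_)
  rw [← complexMGF_id_mul_I, ← complexMGF_id_mul_I]
  exact hstrip (by simpa using h0)

end MomentGeneratingFunction

/-! ### The confluent hypergeometric series -/

section Kummer

open PowerSeries

variable {𝕜 : Type*}

theorem ascFactorial_le_pow_mul_ascFactorial {p q r : ℕ} (hr : 1 ≤ r) (h : p ≤ r * q) (n : ℕ) :
    p.ascFactorial n ≤ r ^ n * q.ascFactorial n := by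
  induction n with
  | zero => simp
  | succ n ih =>
    have hstep : p + n ≤ r * (q + n) := by nlinarith
    calc p.ascFactorial (n + 1) = (p + n) * p.ascFactorial n := Nat.ascFactorial_succ
      _ ≤ r * (q + n) * (r ^ n * q.ascFactorial n) := Nat.mul_le_mul hstep ih
      _ = r ^ (n + 1) * q.ascFactorial (n + 1) := by rw [Nat.ascFactorial_succ]; ring

theorem natCast_ascFactorial_ne_zero [AddMonoidWithOne 𝕜] [CharZero 𝕜] {q : ℕ} (hq : 0 < q)
    (n : ℕ) : (q.ascFactorial n : 𝕜) ≠ 0 := by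
  obtain ⟨q, rfl⟩ := Nat.exists_eq_succ_of_ne_zero hq.ne'
  exact Nat.cast_ne_zero.2 (Nat.ascFactorial_pos q n).ne'

theorem kummer_ode_iff [CommRing 𝕜] (p q u : 𝕜) (F : 𝕜⟦X⟧) :
    X * d⁄dX 𝕜 (d⁄dX 𝕜 F) + (C q - C u * X) * d⁄dX 𝕜 F = C (u * p) * F ↔
      ∀ n : ℕ, (n + 1) * (q + n) * coeff (n + 1) F = u * (p + n) * coeff n F := by
  simp only [PowerSeries.ext_iff, sub_mul, mul_assoc, map_add, map_sub, coeff_C_mul,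
    coeff_X_mul_derivative, coeff_derivative]
  refine forall_congr' fun n => ⟨fun h => ?_, fun h => ?_⟩ <;> linear_combination h

theorem eq_of_kummer_ode [CommRing 𝕜] [IsDomain 𝕜] [CharZero 𝕜] {p q u : 𝕜} {F G : 𝕜⟦X⟧}
    (hq : ∀ n : ℕ, q + n ≠ 0)
    (hF : X * d⁄dX 𝕜 (d⁄dX 𝕜 F) + (C q - C u * X) * d⁄dX 𝕜 F = C (u * p) * F)
    (hG : X * d⁄dX 𝕜 (d⁄dX 𝕜 G) + (C q - C u * X) * d⁄dX 𝕜 G = C (u * p) * G)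
    (h0 : constantCoeff F = constantCoeff G) : F = G := by
  rw [kummer_ode_iff] at hF hG
  ext n
  induction n with
  | zero => simpa only [coeff_zero_eq_constantCoeff_apply] using h0
  | succ n ih =>
    refine mul_left_cancel₀ (mul_ne_zero n.cast_add_one_ne_zero (hq n)) ?_
    rw [hF, hG, ih]

variable [RCLike 𝕜]

variable (𝕜) in
/-- The formal power series of the confluent hypergeometric function `₁F₁(p; q; ·)`. -/
noncomputable def kummerSeries (p q : ℕ) : 𝕜⟦X⟧ :=
  mk fun n => (p.ascFactorial n : 𝕜) / q.ascFactorial n / n.factorial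

theorem kummerTerm_eq (p q n : ℕ) (σ : 𝕜) :
    kummerTerm p q n σ = coeff n (kummerSeries 𝕜 p q) * σ ^ n := by
  rw [kummerTerm, kummerSeries, coeff_mk]
  ring

theorem kummer_eq_seriesSum (p q : ℕ) (σ : 𝕜) : kummer p q σ = seriesSum (kummerSeries 𝕜 p q) σ :=
  tsum_congr fun n => kummerTerm_eq p q n σ

theorem norm_kummerTerm_le {p q r : ℕ} (hr : 1 ≤ r) (h : p ≤ r * q) (n : ℕ) (σ : 𝕜) :
    ‖kummerTerm p q n σ‖ ≤ (r * ‖σ‖) ^ n / n.factorial := by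
  have hasc : (p.ascFactorial n : ℝ) / q.ascFactorial n ≤ r ^ n := by
    refine div_le_of_le_mul₀ (by positivity) (by positivity) ?_
    exact_mod_cast ascFactorial_le_pow_mul_ascFactorial hr h n
  rw [kummerTerm, norm_mul, norm_div, norm_div, norm_pow, RCLike.norm_natCast, RCLike.norm_natCast,
    RCLike.norm_natCast, mul_pow, mul_div_assoc]
  gcongr

theorem norm_kummer_le {p q r : ℕ} (hr : 1 ≤ r) (h : p ≤ r * q) (σ : 𝕜) :
    ‖kummer p q σ‖ ≤ Real.exp (r * ‖σ‖) := by
  rw [Real.exp_eq_exp_ℝ, NormedSpace.exp_eq_tsum_div]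
  exact tsum_of_norm_bounded (Real.summable_pow_div_factorial _).hasSum
    fun n => norm_kummerTerm_le hr h n σ

theorem seriesSum_kummer_ode {p q u : 𝕜} {F : 𝕜⟦X⟧} (hF : F ∈ entireSeries 𝕜)
    (hode : X * d⁄dX 𝕜 (d⁄dX 𝕜 F) + (C q - C u * X) * d⁄dX 𝕜 F = C (u * p) * F) (x : 𝕜) :
    x * seriesSum (d⁄dX 𝕜 (d⁄dX 𝕜 F)) x + (q - u * x) * seriesSum (d⁄dX 𝕜 F) x =
      u * p * seriesSum F x := by
  have hF' := derivative_mem_entireSeries hF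
  let c : 𝕜 → entireSeries 𝕜 := algebraMap 𝕜 (entireSeries 𝕜)
  let Z : entireSeries 𝕜 := ⟨X, X_mem_entireSeries⟩
  have hlift : Z * ⟨_, derivative_mem_entireSeries hF'⟩ + (c q - c u * Z) * ⟨_, hF'⟩ =
      c (u * p) * ⟨F, hF⟩ := Subtype.ext hode
  have heval := congrArg (entireEval x) hlift
  simpa only [c, map_add, map_sub, map_mul, AlgHom.commutes, Algebra.algebraMap_self_apply,
    entireEval_apply, Z, seriesSum_X] using heval

variable {p q : ℕ}

theorem kummerSeries_mem_entireSeries (hq : 0 < q) : kummerSeries 𝕜 p q ∈ entireSeries 𝕜 := by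
  refine mem_entireSeries_of_norm_coeff_le (B := 1) (R := p + 1) fun n => ?_
  have hpq : p ≤ (p + 1) * q := by nlinarith
  have h := norm_kummerTerm_le (𝕜 := 𝕜) (Nat.le_add_left 1 p) hpq n 1
  simpa [kummerTerm_eq] using h

theorem constantCoeff_kummerSeries : constantCoeff (kummerSeries 𝕜 p q) = 1 := by
  simp [kummerSeries]

theorem coeff_succ_kummerSeries (hq : 0 < q) (n : ℕ) :
    (n + 1) * (q + n) * coeff (n + 1) (kummerSeries 𝕜 p q) =
      (p + n) * coeff n (kummerSeries 𝕜 p q) := by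
  have hasc := natCast_ascFactorial_ne_zero (𝕜 := 𝕜) hq (n + 1)
  rw [Nat.ascFactorial_succ] at hasc
  simp only [kummerSeries, coeff_mk, Nat.ascFactorial_succ, Nat.factorial_succ]
  push_cast at hasc ⊢
  have := left_ne_zero_of_mul hasc
  have := right_ne_zero_of_mul hasc
  field_simp

theorem rescale_kummerSeries_ode (hq : 0 < q) (u : 𝕜) :
    X * d⁄dX 𝕜 (d⁄dX 𝕜 (rescale u (kummerSeries 𝕜 p q))) +
      (C (q : 𝕜) - C u * X) * d⁄dX 𝕜 (rescale u (kummerSeries 𝕜 p q)) =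
      C (u * p) * rescale u (kummerSeries 𝕜 p q) := by
  refine (kummer_ode_iff _ _ _ _).2 fun n => ?_
  rw [coeff_rescale, coeff_rescale]
  linear_combination u ^ (n + 1) * coeff_succ_kummerSeries (𝕜 := 𝕜) (p := p) hq n

theorem kummerSeries_ode (hq : 0 < q) :
    X * d⁄dX 𝕜 (d⁄dX 𝕜 (kummerSeries 𝕜 p q)) + (C (q : 𝕜) - X) * d⁄dX 𝕜 (kummerSeries 𝕜 p q) =
      C (p : 𝕜) * kummerSeries 𝕜 p q := by
  simpa using rescale_kummerSeries_ode (𝕜 := 𝕜) (p := p) hq 1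

theorem derivative_kummerSeries (hq : 0 < q) :
    C (q : 𝕜) * d⁄dX 𝕜 (kummerSeries 𝕜 p q) = C (p : 𝕜) * kummerSeries 𝕜 (p + 1) (q + 1) := by
  ext n
  have hp : (p * (p + 1).ascFactorial n : 𝕜) = p.ascFactorial (n + 1) := by
    rw [Nat.ascFactorial_succ]; exact_mod_cast Nat.succ_ascFactorial p n
  have hq' : (q * (q + 1).ascFactorial n : 𝕜) = q.ascFactorial (n + 1) := by
    rw [Nat.ascFactorial_succ]; exact_mod_cast Nat.succ_ascFactorial q n
  have hasc := natCast_ascFactorial_ne_zero (𝕜 := 𝕜) hq (n + 1)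
  rw [← hq'] at hasc
  have := left_ne_zero_of_mul hasc
  have := right_ne_zero_of_mul hasc
  simp only [kummerSeries, coeff_C_mul, coeff_derivative, coeff_mk, ← hp, ← hq',
    Nat.factorial_succ, Nat.cast_mul, Nat.cast_succ]
  field_simp

theorem seriesSum_derivative_kummerSeries (hq : 0 < q) (σ : 𝕜) :
    q * seriesSum (d⁄dX 𝕜 (kummerSeries 𝕜 p q)) σ = p * kummer (p + 1) (q + 1) σ := by
  rw [kummer_eq_seriesSum, ← seriesSum_C_mul, derivative_kummerSeries hq, seriesSum_C_mul]

theorem seriesSum_derivative_derivative_kummerSeries (hq : 0 < q) (σ : 𝕜) :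
    q * (q + 1) * seriesSum (d⁄dX 𝕜 (d⁄dX 𝕜 (kummerSeries 𝕜 p q))) σ =
      p * (p + 1) * kummer (p + 2) (q + 2) σ := by
  have hderiv : C (q : 𝕜) * d⁄dX 𝕜 (d⁄dX 𝕜 (kummerSeries 𝕜 p q)) =
      C (p : 𝕜) * d⁄dX 𝕜 (kummerSeries 𝕜 (p + 1) (q + 1)) := by
    rw [← derivative_C_mul, derivative_kummerSeries hq, derivative_C_mul]
  have hsum := congrArg (seriesSum · σ) hderiv
  have hsum_succ := seriesSum_derivative_kummerSeries (𝕜 := 𝕜) (p := p + 1) q.succ_pos σ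
  simp only [seriesSum_C_mul, Nat.succ_eq_add_one, Nat.cast_add_one] at hsum hsum_succ
  linear_combination (q + 1 : 𝕜) * hsum + p * hsum_succ

theorem kummer_contiguous (hp : 0 < p) (hq : 0 < q) (σ : 𝕜) :
    σ * (p + 1) * kummer (p + 2) (q + 2) σ + (q - σ) * (q + 1) * kummer (p + 1) (q + 1) σ =
      q * (q + 1) * kummer p q σ := by
  have hp0 : (p : 𝕜) ≠ 0 := Nat.cast_ne_zero.2 hp.ne'
  have hK := kummerSeries_mem_entireSeries (𝕜 := 𝕜) (p := p) hq
  have hode := seriesSum_kummer_ode (u := 1) hK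
    (by simpa only [map_one, one_mul] using kummerSeries_ode hq) σ
  have hderiv := seriesSum_derivative_kummerSeries (𝕜 := 𝕜) (p := p) hq σ
  have hderiv₂ := seriesSum_derivative_derivative_kummerSeries (𝕜 := 𝕜) (p := p) hq σ
  rw [← kummer_eq_seriesSum] at hode
  refine mul_left_cancel₀ hp0 ?_
  linear_combination (q * (q + 1) : 𝕜) * hode - σ * hderiv₂ - (q - σ) * (q + 1) * hderiv

theorem kummer_neg (hq : 0 < p + q) (σ : 𝕜) :
    kummer p (p + q) (-σ) = NormedSpace.exp (-σ) * kummer q (p + q) σ := by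
  have hseries : rescale (-1) (kummerSeries 𝕜 p (p + q)) =
      rescale (-1) (exp 𝕜) * kummerSeries 𝕜 q (p + q) := by
    refine eq_of_kummer_ode (fun n => ?_) (rescale_kummerSeries_ode hq (-1)) ?_ ?_
    · exact_mod_cast (Nat.add_pos_left hq n).ne'
    · have hode := kummerSeries_ode (𝕜 := 𝕜) (p := q) hq
      simp only [Derivation.leibniz, Derivation.map_one_eq_zero, derivative_rescale,
        derivative_exp, smul_eq_mul, map_add, map_neg, map_one, map_mul, Nat.cast_add] at hode ⊢
      linear_combination rescale (-1) (exp 𝕜) * hode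
    · simp [constantCoeff_kummerSeries, constantCoeff_rescale]
  have hE := rescale_mem_entireSeries (exp_mem_entireSeries (𝕜 := 𝕜)) (-1)
  have hsum := congrArg (seriesSum · σ) hseries
  simp only [seriesSum_mul hE (kummerSeries_mem_entireSeries hq), seriesSum_rescale,
    seriesSum_exp, neg_one_mul, ← kummer_eq_seriesSum] at hsum
  exact hsum

theorem kummer_neg_nonneg {p q : ℕ} (hq : 0 < q) (h : p ≤ q) {y : ℝ} (hy : 0 ≤ y) :
    0 ≤ kummer p q (-y) := by
  obtain ⟨r, rfl⟩ := Nat.exists_eq_add_of_le h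
  rw [kummer_neg hq, ← Real.exp_eq_exp_ℝ]
  refine mul_nonneg (Real.exp_pos _).le (tsum_nonneg fun n => ?_)
  rw [kummerTerm]
  positivity

end Kummer

/-! ### The moment generating function -/

section Mgf

open PowerSeries

variable {𝕜 : Type*} [RCLike 𝕜]

/-- The function `s ↦ (1 - Γ s)⁻ᵏ F(Γ s / (1 - Γ s))`, for an entire power series `F`; the family of
these functions is closed under differentiation in `s`. -/
noncomputable def mobiusSum (Γ : 𝕜) (k : ℕ) (F : 𝕜⟦X⟧) (s : 𝕜) : 𝕜 :=
  1 / (1 - Γ * s) ^ k * seriesSum F (Γ * s / (1 - Γ * s))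

theorem zfMgf_eq_mobiusSum (N NR : ℕ) (Γ s a : 𝕜) :
    zfMgf N NR Γ s a = mobiusSum Γ N (rescale a (kummerSeries 𝕜 N NR)) s := by
  rw [zfMgf, mobiusSum, kummer_eq_seriesSum, seriesSum_rescale]

variable {Γ s : 𝕜} {F : 𝕜⟦X⟧}

theorem hasDerivAt_mobiusSum (hF : F ∈ entireSeries 𝕜) (k : ℕ) (hs : 1 - Γ * s ≠ 0) :
    HasDerivAt (mobiusSum Γ k F)
      (k * Γ * mobiusSum Γ (k + 1) F s + Γ * mobiusSum Γ (k + 2) (d⁄dX 𝕜 F) s) s := by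
  have hnum : HasDerivAt (fun s : 𝕜 => Γ * s) Γ s := by
    simpa using (hasDerivAt_id s).const_mul Γ
  have hden := hnum.const_sub 1
  have hpow := (hasDerivAt_const s (1 : 𝕜)).div (hden.pow k) (pow_ne_zero k hs)
  refine (hpow.mul ((hasDerivAt_seriesSum hF _).comp s (hnum.div hden hs))).congr_deriv ?_
  simp only [mobiusSum, Function.comp_apply, Pi.pow_apply]
  cases k <;>
    simp only [Pi.div_apply, Pi.pow_apply, Nat.cast_zero, Nat.cast_succ, Nat.add_sub_cancel] <;>
    field_simp <;>
    ring

theorem contDiffAt_mobiusSum (hF : F ∈ entireSeries 𝕜) (k n : ℕ) (hs : 1 - Γ * s ≠ 0) :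
    ContDiffAt 𝕜 n (mobiusSum Γ k F) s := by
  have hden : ContDiffAt 𝕜 n (fun s => 1 - Γ * s) s := by fun_prop
  have hnum : ContDiffAt 𝕜 n (fun s => Γ * s) s := by fun_prop
  exact (contDiffAt_const.div (hden.pow k) (pow_ne_zero k hs)).mul
    ((contDiff_seriesSum hF n).contDiffAt.comp s (hnum.div hden hs))

theorem iteratedDeriv_two_mobiusSum (hF : F ∈ entireSeries 𝕜) (k : ℕ) (hs : 1 - Γ * s ≠ 0) :
    iteratedDeriv 2 (mobiusSum Γ k F) s = Γ ^ 2 * (k * (k + 1) * mobiusSum Γ (k + 2) F s +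
      2 * (k + 1) * mobiusSum Γ (k + 3) (d⁄dX 𝕜 F) s +
      mobiusSum Γ (k + 4) (d⁄dX 𝕜 (d⁄dX 𝕜 F)) s) := by
  have hderiv : deriv (mobiusSum Γ k F) =ᶠ[nhds s] fun s =>
      k * Γ * mobiusSum Γ (k + 1) F s + Γ * mobiusSum Γ (k + 2) (d⁄dX 𝕜 F) s :=
    (ContinuousAt.eventually_ne (g := fun s => 1 - Γ * s) (by fun_prop) hs).mono
      fun s hs => (hasDerivAt_mobiusSum hF k hs).deriv
  rw [iteratedDeriv_succ, iteratedDeriv_one, hderiv.deriv_eq]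
  refine (((hasDerivAt_mobiusSum hF (k + 1) hs).const_mul (k * Γ)).add
    ((hasDerivAt_mobiusSum (derivative_mem_entireSeries hF) (k + 2) hs).const_mul Γ)).deriv.trans ?_
  push_cast
  ring

theorem mobiusSum_ode {b a : 𝕜} (n : ℕ) (hF : F ∈ entireSeries 𝕜)
    (hode : X * d⁄dX 𝕜 (d⁄dX 𝕜 F) + (C b - C a * X) * d⁄dX 𝕜 F = C (a * n) * F)
    (hs : 1 - Γ * s ≠ 0) :
    s * (1 - Γ * s) ^ 2 * iteratedDeriv 2 (mobiusSum Γ n F) s +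
      (b * (1 - Γ * s) - 2 * (n + 1) * (Γ * s * (1 - Γ * s)) - a * Γ * s) *
        deriv (mobiusSum Γ n F) s +
      n * Γ * ((n + 1) * Γ * s - b - a) * mobiusSum Γ n F s = 0 := by
  have h := seriesSum_kummer_ode hF hode (Γ * s / (1 - Γ * s))
  rw [iteratedDeriv_two_mobiusSum hF n hs, (hasDerivAt_mobiusSum hF n hs).deriv]
  simp only [mobiusSum, pow_add]
  field_simp at h ⊢
  linear_combination Γ * h

theorem isHolonomicFst_zfMgf (N : ℕ) {NR : ℕ} (hNR : 0 < NR) (Γ : 𝕜) :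
    IsHolonomicFst (fun s a : 𝕜 => zfMgf N NR Γ s a) {q | 1 - Γ * q.1 ≠ 0} := by
  let s : MvPolynomial (Fin 2) 𝕜 := .X 0
  let a : MvPolynomial (Fin 2) 𝕜 := .X 1
  let g : MvPolynomial (Fin 2) 𝕜 := .C Γ
  let b : MvPolynomial (Fin 2) 𝕜 := .C (NR : 𝕜)
  refine ⟨2, fun i => match i with
    | 0 => N * g * ((N + 1) * g * s - b - a)
    | 1 => b * (1 - g * s) - 2 * (N + 1) * (g * s * (1 - g * s)) - a * g * s
    | _ => s * (1 - g * s) ^ 2, fun s₀ a₀ hs₀ => ?_⟩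
  have hK := rescale_mem_entireSeries (kummerSeries_mem_entireSeries (𝕜 := 𝕜) (p := N) hNR) a₀
  simp only [zfMgf_eq_mobiusSum]
  refine ⟨?_, contDiffAt_mobiusSum hK N 2 hs₀, ?_⟩
  · obtain ⟨s₁, hs₁⟩ := Infinite.exists_notMem_finset ({0, Γ⁻¹} : Finset 𝕜)
    obtain ⟨hs₁, hΓ⟩ : s₁ ≠ 0 ∧ s₁ ≠ Γ⁻¹ := by simpa using hs₁
    have hv : 1 - Γ * s₁ ≠ 0 := fun h => hΓ (eq_inv_of_mul_eq_one_right (sub_eq_zero.1 h).symm)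
    exact ⟨s₁, by simp [s, g, hs₁, hv]⟩
  · have h := mobiusSum_ode N hK (rescale_kummerSeries_ode hNR a₀) hs₀
    simp only [Finset.sum_range_succ, Finset.range_zero, Finset.sum_empty, iteratedDeriv_zero,
      iteratedDeriv_one, s, a, g, b, map_mul, map_pow, map_sub, map_add, map_one, map_natCast,
      map_ofNat, MvPolynomial.eval_X, MvPolynomial.eval_C, Matrix.cons_val_zero,
      Matrix.cons_val_one]
    linear_combination h

theorem isHolonomicFst_zfMgf_swap (N : ℕ) {NR : ℕ} (hNR : 0 < NR) (Γ : 𝕜) :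
    IsHolonomicFst (fun a s : 𝕜 => zfMgf N NR Γ s a)
      (Prod.swap ⁻¹' {q : 𝕜 × 𝕜 | 1 - Γ * q.1 ≠ 0}) := by
  let a : MvPolynomial (Fin 2) 𝕜 := .X 0
  let s : MvPolynomial (Fin 2) 𝕜 := .X 1
  let g : MvPolynomial (Fin 2) 𝕜 := .C Γ
  let b : MvPolynomial (Fin 2) 𝕜 := .C (NR : 𝕜)
  refine .of_powerSeries 2 (fun i => match i with
    | 0 => -N * g * s
    | 1 => b * (1 - g * s) - a * g * s
    | _ => (1 - g * s) * a)
    (fun s => C (1 / (1 - Γ * s) ^ N) * rescale (Γ * s / (1 - Γ * s)) (kummerSeries 𝕜 N NR))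
    (fun a₀ s₀ hs₀ => ⟨1, ?_⟩) (fun a₀ s₀ _ => ?_) (fun a₀ s₀ _ a₁ => ?_) (fun a₀ s₀ hs₀ => ?_)
  · simpa [s, a, g] using hs₀
  · exact mul_mem (C_mem_entireSeries _)
      (rescale_mem_entireSeries (kummerSeries_mem_entireSeries hNR) _)
  · rw [zfMgf, kummer_eq_seriesSum, seriesSum_C_mul, seriesSum_rescale, mul_comm a₁]
  · have hv : 1 - Γ * s₀ ≠ 0 := hs₀
    have hode := rescale_kummerSeries_ode (𝕜 := 𝕜) (p := N) hNR (Γ * s₀ / (1 - Γ * s₀))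
    have hu : (1 - C Γ * C s₀) * C (Γ * s₀ / (1 - Γ * s₀)) = C Γ * C s₀ := by
      rw [← map_one C, ← map_mul, ← map_sub, ← map_mul, mul_div_cancel₀ _ hv]
    set K := rescale (Γ * s₀ / (1 - Γ * s₀)) (kummerSeries 𝕜 N NR)
    simp only [Finset.sum_range_succ, Finset.range_zero, Finset.sum_empty, Function.iterate_succ,
      Function.iterate_zero, Function.comp_apply, id_eq, derivative_C_mul]
    simp only [s, a, g, b, map_mul, map_sub, map_neg, map_one, map_natCast, MvPolynomial.aeval_X,
      MvPolynomial.aeval_C, Matrix.cons_val_zero, Matrix.cons_val_one,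
      PowerSeries.algebraMap_apply, Algebra.algebraMap_self_apply] at hode ⊢
    linear_combination C (1 / (1 - Γ * s₀) ^ N) *
      ((1 - C Γ * C s₀) * hode + (N * K + X * d⁄dX 𝕜 K) * hu)

theorem isHolonomic_zfMgf (N : ℕ) {NR : ℕ} (hNR : 0 < NR) (Γ : 𝕜) :
    IsHolonomic (fun s a : 𝕜 => zfMgf N NR Γ s a) {q | 1 - Γ * q.1 ≠ 0} :=
  ⟨isHolonomicFst_zfMgf N hNR Γ, isHolonomicFst_zfMgf_swap N hNR Γ⟩

end Mgf

/-! ### The density -/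

section Pdf

open PowerSeries fwdDiff Finset.HasAntidiagonal

theorem tsum_sum_antidiagonal {E : Type*} [NormedAddCommGroup E] [CompleteSpace E] {f : ℕ × ℕ → E}
    (hf : Summable f) : ∑' n, ∑ p ∈ antidiagonal n, f p = ∑' j, ∑' i, f (i, j) := by
  have hσ := (sigmaAntidiagonalEquivProd (A := ℕ)).summable_iff.2 hf
  calc ∑' n, ∑ p ∈ antidiagonal n, f p
      = ∑' n, ∑' p : antidiagonal n, f p := tsum_congr fun n => (Finset.tsum_subtype _ _).symm
    _ = ∑' p, f p :=
      hσ.tsum_sigma.symm.trans ((sigmaAntidiagonalEquivProd (A := ℕ)).tsum_eq f)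
    _ = ∑' j, ∑' i, f (i, j) := by
      rw [← (Equiv.prodComm ℕ ℕ).tsum_eq f]
      exact ((Equiv.prodComm ℕ ℕ).summable_iff.2 hf).tsum_prod

variable {𝕜 : Type*} [RCLike 𝕜]

/-- The density at `t` of the Erlang distribution, i.e. of the sum of `n + 1` independent
exponential variables of mean `Γ`. The shape is shifted by one so that `n` ranges over all of `ℕ`;
it comes last because differences are taken with respect to it. -/
noncomputable def erlangPdf (Γ t : 𝕜) (n : ℕ) : 𝕜 :=
  t ^ n * NormedSpace.exp (-t / Γ) / (n.factorial * Γ ^ (n + 1))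

theorem succ_mul_erlangPdf_succ (Γ t : 𝕜) (n : ℕ) :
    (n + 1) * erlangPdf Γ t (n + 1) = t * Γ⁻¹ * erlangPdf Γ t n := by
  have hn : (n + 1 : 𝕜) * (n + 1 : 𝕜)⁻¹ = 1 := mul_inv_cancel₀ n.cast_add_one_ne_zero
  simp only [erlangPdf, Nat.factorial_succ, Nat.cast_mul, Nat.cast_succ, div_eq_mul_inv, mul_inv,
    pow_succ]
  linear_combination
    t ^ n * t * NormedSpace.exp (-t * Γ⁻¹) * (n.factorial : 𝕜)⁻¹ * ((Γ ^ n)⁻¹ * Γ⁻¹ * Γ⁻¹) * hn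

theorem norm_erlangPdf_le (Γ t : 𝕜) (n : ℕ) :
    ‖erlangPdf Γ t n‖ ≤ ‖NormedSpace.exp (-t / Γ)‖ / ‖Γ‖ * Real.exp (‖t‖ / ‖Γ‖) :=
  calc ‖erlangPdf Γ t n‖
      = ‖NormedSpace.exp (-t / Γ)‖ / ‖Γ‖ * ((‖t‖ / ‖Γ‖) ^ n / n.factorial) := by
        rw [erlangPdf, norm_div, norm_mul, norm_mul, norm_pow, norm_pow, RCLike.norm_natCast,
          pow_succ, div_pow]
        ring
    _ ≤ _ := by gcongr; exact Real.pow_div_factorial_le_exp _ (by positivity) n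

theorem zfPdf_eq_tsum_fwdDiff (m NR : ℕ) (Γ t a : 𝕜) :
    zfPdf (m + 1) NR Γ t a = ∑' n, kummerTerm (m + 1) NR n a * (Δ_[1])^[n] (erlangPdf Γ t) m := by
  refine tsum_congr fun n => ?_
  rw [fwdDiff_iter_eq_sum_antidiagonal, Finset.Nat.sum_antidiagonal_eq_sum_range_succ
    (fun i j => (n.choose i : 𝕜) * (-1) ^ i * erlangPdf Γ t (m + j))]
  congr 1
  refine Finset.sum_congr rfl fun i hi => ?_
  obtain ⟨j, rfl⟩ := Nat.exists_eq_add_of_le (Finset.mem_range_succ_iff.1 hi)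
  rw [erlangPdf, Nat.add_sub_cancel_left,
    show m + 1 + (i + j) - i = m + j + 1 by lia, Nat.add_sub_cancel]
  ring

/-- The density `zfPdf (m + 1) NR Γ t` at the fixed time `t`, as a power series in `a`. -/
noncomputable def zfPdfSeries (m NR : ℕ) (Γ t : 𝕜) : 𝕜⟦X⟧ :=
  mk fun n => coeff n (kummerSeries 𝕜 (m + 1) NR) * (Δ_[1])^[n] (erlangPdf Γ t) m

theorem zfPdf_eq_seriesSum (m NR : ℕ) (Γ t a : 𝕜) :
    zfPdf (m + 1) NR Γ t a = seriesSum (zfPdfSeries m NR Γ t) a := by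
  rw [zfPdf_eq_tsum_fwdDiff]
  exact tsum_congr fun n => by rw [kummerTerm_eq, zfPdfSeries, coeff_mk]; ring

theorem zfPdfSeries_mem_entireSeries (m : ℕ) {NR : ℕ} (hNR : 0 < NR) (Γ t : 𝕜) :
    zfPdfSeries m NR Γ t ∈ entireSeries 𝕜 := by
  refine mem_entireSeries_of_norm_coeff_le (R := 2 * (m + 1))
    (B := ‖NormedSpace.exp (-t / Γ)‖ / ‖Γ‖ * Real.exp (‖t‖ / ‖Γ‖)) fun n => ?_
  have hK := norm_kummerTerm_le (𝕜 := 𝕜) (Nat.le_add_left 1 m)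
    (Nat.le_mul_of_pos_right (m + 1) hNR) n 1
  have hD := norm_fwdDiff_iter_le (norm_erlangPdf_le Γ t) n m
  rw [kummerTerm_eq, one_pow, mul_one, norm_one, mul_one, Nat.cast_succ] at hK
  rw [zfPdfSeries, coeff_mk, norm_mul]
  refine (mul_le_mul hK hD (norm_nonneg _) (by positivity)).trans_eq ?_
  rw [mul_pow]
  ring

theorem coeff_zfPdfSeries_recurrence (m : ℕ) {NR : ℕ} (hNR : 0 < NR) (Γ t : 𝕜) (n : ℕ) :
    (n + 2) * (NR + n + 1) * (NR + n) * coeff (n + 2) (zfPdfSeries m NR Γ t) +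
      (NR + n) * (m + 1 + 2 * (n + 1) - t * Γ⁻¹) * coeff (n + 1) (zfPdfSeries m NR Γ t) +
      (m + 1 + n) * coeff n (zfPdfSeries m NR Γ t) = 0 := by
  have hK := coeff_succ_kummerSeries (𝕜 := 𝕜) (p := m + 1) hNR n
  have hK_succ := coeff_succ_kummerSeries (𝕜 := 𝕜) (p := m + 1) hNR (n + 1)
  have hD := fwdDiff_iter_recurrence (succ_mul_erlangPdf_succ Γ t) (n + 1) m
  simp only [zfPdfSeries, coeff_mk, Nat.add_sub_cancel] at hD ⊢
  push_cast at hK hK_succ hD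
  set D := fun n => (Δ_[1])^[n] (erlangPdf Γ t) m
  set K := fun n => coeff n (kummerSeries 𝕜 (m + 1) NR)
  linear_combination (NR + n : 𝕜) * D (n + 2) * hK_succ + (NR + n) * K (n + 1) * hD - D n * hK

theorem zfPdfSeries_ode (m : ℕ) {NR : ℕ} (hNR : 0 < NR) (Γ t : 𝕜) :
    X ^ 2 * d⁄dX 𝕜 (d⁄dX 𝕜 (d⁄dX 𝕜 (zfPdfSeries m NR Γ t))) +
      (C (2 * NR : 𝕜) * X + C 2 * X ^ 2) * d⁄dX 𝕜 (d⁄dX 𝕜 (zfPdfSeries m NR Γ t)) +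
      (C (NR * (NR - 1) : 𝕜) + C (m + 1 - t * Γ⁻¹ + 2 * NR) * X + X ^ 2) *
        d⁄dX 𝕜 (zfPdfSeries m NR Γ t) +
      (C ((m + 1 - t * Γ⁻¹) * (NR - 1)) + C (m + 1 : 𝕜) * X) * zfPdfSeries m NR Γ t = 0 := by
  have hrec := coeff_zfPdfSeries_recurrence m hNR Γ t
  have hzero := fwdDiff_iter_recurrence (succ_mul_erlangPdf_succ Γ t) 0 m
  have hK := coeff_succ_kummerSeries (𝕜 := 𝕜) (p := m + 1) hNR 0
  ext n
  simp only [pow_two, add_mul, mul_assoc, map_add, coeff_C_mul, map_zero]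
  cases n with
  | zero =>
    simp only [coeff_zero_X_mul, coeff_derivative]
    simp only [zfPdfSeries, coeff_mk]
    push_cast at hzero hK ⊢
    linear_combination (NR - 1 : 𝕜) * (Δ_[1])^[1] (erlangPdf Γ t) m * hK +
      (NR - 1) * coeff 0 (kummerSeries 𝕜 (m + 1) NR) * hzero
  | succ n =>
    simp only [coeff_X_mul_derivative, coeff_succ_X_mul, coeff_derivative]
    push_cast
    linear_combination hrec n

theorem isHolonomicFst_zfPdf_swap {N NR : ℕ} (hN : 0 < N) (hNR : 0 < NR) (Γ : 𝕜) :
    IsHolonomicFst (fun a t : 𝕜 => zfPdf N NR Γ t a) Set.univ := by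
  obtain ⟨m, rfl⟩ := Nat.exists_eq_succ_of_ne_zero hN.ne'
  let a : MvPolynomial (Fin 2) 𝕜 := .X 0
  let d : MvPolynomial (Fin 2) 𝕜 := m + 1 - .X 1 * .C Γ⁻¹
  let b : MvPolynomial (Fin 2) 𝕜 := .C (NR : 𝕜)
  refine .of_powerSeries 3 (fun i => match i with
    | 0 => d * (b - 1) + (m + 1) * a
    | 1 => b * (b - 1) + (d + 2 * b) * a + a ^ 2
    | 2 => 2 * b * a + 2 * a ^ 2
    | _ => a ^ 2) (zfPdfSeries m NR Γ)
    (fun _ _ _ => ⟨1, by simp [a]⟩)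
    (fun _ t _ => zfPdfSeries_mem_entireSeries m hNR Γ t)
    (fun _ t _ a => zfPdf_eq_seriesSum m NR Γ t a)
    (fun _ t _ => ?_)
  have hode := zfPdfSeries_ode m hNR Γ t
  simp only [Finset.sum_range_succ, Finset.range_zero, Finset.sum_empty, Function.iterate_succ,
    Function.iterate_zero, Function.comp_apply, id_eq]
  simp only [a, d, b, map_mul, map_pow, map_add, map_sub, map_one, map_ofNat, map_natCast,
    MvPolynomial.aeval_X, MvPolynomial.aeval_C, Matrix.cons_val_zero, Matrix.cons_val_one,
    PowerSeries.algebraMap_apply, Algebra.algebraMap_self_apply] at hode ⊢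
  linear_combination hode

/-! ### The density in time -/

theorem kummerTerm_add (p q i j : ℕ) (a : 𝕜) :
    (i + j).choose i * (-1) ^ i * kummerTerm p q (i + j) a =
      kummerTerm p q j a * kummerTerm (p + j) (q + j) i (-a) := by
  have hp : (p.ascFactorial (i + j) : 𝕜) = p.ascFactorial j * (p + j).ascFactorial i := by
    rw [add_comm i j]; exact_mod_cast (Nat.ascFactorial_mul_ascFactorial p j i).symm
  have hq : (q.ascFactorial (i + j) : 𝕜) = q.ascFactorial j * (q + j).ascFactorial i := by
    rw [add_comm i j]; exact_mod_cast (Nat.ascFactorial_mul_ascFactorial q j i).symm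
  have hchoose : ((i + j).choose i : 𝕜) * ((i + j).factorial : 𝕜)⁻¹ =
      (i.factorial : 𝕜)⁻¹ * (j.factorial : 𝕜)⁻¹ := by
    have := Nat.cast_ne_zero (R := 𝕜).2 (i + j).factorial_ne_zero
    rw [Nat.cast_add_choose]
    field_simp
  simp only [kummerTerm, hp, hq, neg_pow a, pow_add, div_eq_mul_inv, mul_inv]
  linear_combination (p.ascFactorial j * (p + j).ascFactorial i * (q.ascFactorial j : 𝕜)⁻¹ *
    ((q + j).ascFactorial i : 𝕜)⁻¹ * a ^ i * a ^ j * (-1) ^ i) * hchoose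

theorem summable_erlangPdf_mul_kummerTerm (m : ℕ) {NR : ℕ} (hNR : 0 < NR) (Γ t a : 𝕜) :
    Summable fun p : ℕ × ℕ => erlangPdf Γ t (m + p.2) *
      (kummerTerm (m + 1) NR p.2 a * kummerTerm (m + 1 + p.2) (NR + p.2) p.1 (-a)) := by
  have hexp := Real.summable_pow_div_factorial ((m + 1 : ℕ) * ‖a‖)
  refine .of_norm_bounded ((hexp.mul_of_nonneg hexp (fun _ => by positivity)
    fun _ => by positivity).mul_left
    (‖NormedSpace.exp (-t / Γ)‖ / ‖Γ‖ * Real.exp (‖t‖ / ‖Γ‖))) fun p => ?_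
  have hle : ∀ k, m + 1 + k ≤ (m + 1) * (NR + k) := fun k => by nlinarith
  have hK := norm_kummerTerm_le (Nat.le_add_left 1 m) (Nat.le_mul_of_pos_right (m + 1) hNR) p.2 a
  have hK' := norm_kummerTerm_le (Nat.le_add_left 1 m) (hle p.2) p.1 (-a)
  rw [norm_neg] at hK'
  rw [norm_mul, norm_mul, mul_comm (_ / _ : ℝ) (_ / (p.2.factorial : ℝ))]
  gcongr
  exact norm_erlangPdf_le Γ t _

theorem zfPdf_eq_tsum_erlangPdf (m : ℕ) {NR : ℕ} (hNR : 0 < NR) (Γ t a : 𝕜) :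
    zfPdf (m + 1) NR Γ t a = ∑' k, erlangPdf Γ t (m + k) *
      (kummerTerm (m + 1) NR k a * kummer (m + 1 + k) (NR + k) (-a)) := by
  have hterm : ∀ n, kummerTerm (m + 1) NR n a * (Δ_[1])^[n] (erlangPdf Γ t) m =
      ∑ p ∈ antidiagonal n, erlangPdf Γ t (m + p.2) *
        (kummerTerm (m + 1) NR p.2 a * kummerTerm (m + 1 + p.2) (NR + p.2) p.1 (-a)) := by
    intro n
    rw [fwdDiff_iter_eq_sum_antidiagonal, Finset.mul_sum]
    refine Finset.sum_congr rfl fun p hp => ?_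
    rw [← mem_antidiagonal.1 hp, ← kummerTerm_add]
    ring
  rw [zfPdf_eq_tsum_fwdDiff, tsum_congr hterm,
    tsum_sum_antidiagonal (summable_erlangPdf_mul_kummerTerm m hNR Γ t a)]
  simp only [tsum_mul_left, kummer]

/-- The power series of `(m! / t ^ m) exp(t) p(t, a)` in the time `t`, where `p` is the density
`zfPdf (m + 1) NR` of scale `1`. -/
noncomputable def zfPdfFactor (m NR : ℕ) (a : 𝕜) : 𝕜⟦X⟧ :=
  mk fun k => a ^ k / (NR.ascFactorial k * k.factorial) * kummer (m + 1 + k) (NR + k) (-a)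

/-- The power series of `m! p(t, a)` in the time `t`, where `p` is the density `zfPdf (m + 1) NR`
of scale `1`. -/
noncomputable def zfPdfTimeSeries (m NR : ℕ) (a : 𝕜) : 𝕜⟦X⟧ :=
  X ^ m * (rescale (-1) (exp 𝕜) * zfPdfFactor m NR a)

theorem zfPdfFactor_mem_entireSeries (m : ℕ) {NR : ℕ} (hNR : 0 < NR) (a : 𝕜) :
    zfPdfFactor m NR a ∈ entireSeries 𝕜 := by
  refine mem_entireSeries_of_norm_coeff_le (B := Real.exp ((m + 1 : ℕ) * ‖a‖)) (R := ‖a‖)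
    fun k => ?_
  have hasc : (1 : ℝ) ≤ NR.ascFactorial k := by
    exact_mod_cast Nat.one_le_iff_ne_zero.2
      (Nat.cast_ne_zero (R := 𝕜).1 (natCast_ascFactorial_ne_zero hNR k))
  have hK := norm_kummer_le (q := NR + k) (Nat.le_add_left 1 m)
    (show m + 1 + k ≤ (m + 1) * (NR + k) by nlinarith) (-a)
  rw [norm_neg] at hK
  rw [zfPdfFactor, coeff_mk, norm_mul, norm_div, norm_mul, norm_pow, RCLike.norm_natCast,
    RCLike.norm_natCast, mul_comm]
  gcongr
  exact le_mul_of_one_le_left (by positivity) hasc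

theorem zfPdfTimeSeries_mem_entireSeries (m : ℕ) {NR : ℕ} (hNR : 0 < NR) (a : 𝕜) :
    zfPdfTimeSeries m NR a ∈ entireSeries 𝕜 :=
  mul_mem (pow_mem X_mem_entireSeries m) (mul_mem
    (rescale_mem_entireSeries exp_mem_entireSeries _) (zfPdfFactor_mem_entireSeries m hNR a))

theorem seriesSum_zfPdfTimeSeries (m : ℕ) {NR : ℕ} (hNR : 0 < NR) (a x : 𝕜) :
    seriesSum (zfPdfTimeSeries m NR a) x =
      x ^ m * (NormedSpace.exp (-x) * seriesSum (zfPdfFactor m NR a) x) := by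
  have hE := rescale_mem_entireSeries (exp_mem_entireSeries (𝕜 := 𝕜)) (-1)
  have hF := zfPdfFactor_mem_entireSeries m hNR a
  have hX : seriesSum (X ^ m : 𝕜⟦X⟧) x = x ^ m :=
    (map_pow (entireEval x) ⟨X, X_mem_entireSeries⟩ m).trans (congrArg (· ^ m) (seriesSum_X x))
  rw [zfPdfTimeSeries, seriesSum_mul (pow_mem X_mem_entireSeries m) (mul_mem hE hF),
    seriesSum_mul hE hF, hX, seriesSum_rescale, seriesSum_exp, neg_one_mul]

theorem zfPdf_eq_seriesSum_time (m : ℕ) {NR : ℕ} (hNR : 0 < NR) (Γ t a : 𝕜) :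
    zfPdf (m + 1) NR Γ t a =
      seriesSum (C (Γ⁻¹ / m.factorial) * rescale Γ⁻¹ (zfPdfTimeSeries m NR a)) t := by
  rw [zfPdf_eq_tsum_erlangPdf m hNR, seriesSum_C_mul, seriesSum_rescale,
    seriesSum_zfPdfTimeSeries m hNR, seriesSum, ← tsum_mul_left, ← tsum_mul_left, ← tsum_mul_left]
  refine tsum_congr fun k => ?_
  have hfact : ((m + k).factorial : 𝕜)⁻¹ * (m + 1).ascFactorial k = (m.factorial : 𝕜)⁻¹ := by
    have := Nat.cast_ne_zero (R := 𝕜).2 m.factorial_ne_zero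
    have := Nat.cast_ne_zero (R := 𝕜).2 (m + k).factorial_ne_zero
    have := congrArg (Nat.cast (R := 𝕜)) (Nat.factorial_mul_ascFactorial m k)
    push_cast at this
    field_simp
    linear_combination this
  simp only [zfPdfFactor, coeff_mk, erlangPdf, kummerTerm, div_eq_mul_inv, mul_inv, mul_pow,
    pow_add, pow_one, inv_pow, neg_mul, mul_comm Γ⁻¹ t]
  linear_combination t ^ m * t ^ k * NormedSpace.exp (-(t * Γ⁻¹)) *
    ((Γ ^ m)⁻¹ * (Γ ^ k)⁻¹ * Γ⁻¹) * ((NR.ascFactorial k : 𝕜)⁻¹ * (a ^ k * (k.factorial : 𝕜)⁻¹) *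
    kummer (m + 1 + k) (NR + k) (-a)) * hfact

theorem coeff_zfPdfFactor_recurrence (m : ℕ) {NR : ℕ} (hNR : 0 < NR) (a : 𝕜) (n : ℕ) :
    (n + 2) * (n + 1) * (m + n + 2) * coeff (n + 2) (zfPdfFactor m NR a) -
      (n + 1) * (NR + n + a) * coeff (n + 1) (zfPdfFactor m NR a) +
      a * coeff n (zfPdfFactor m NR a) = 0 := by
  have hK := kummer_contiguous (p := m + 1 + n) (q := NR + n) (by lia) (by lia) (-a)
  have hasc := natCast_ascFactorial_ne_zero (𝕜 := 𝕜) hNR (n + 2)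
  simp only [zfPdfFactor, coeff_mk, Nat.ascFactorial_succ, Nat.factorial_succ] at hasc ⊢
  push_cast at hasc hK ⊢
  obtain ⟨hq_succ, hq, hasc⟩ := by simpa only [mul_ne_zero_iff] using hasc
  have := Nat.cast_ne_zero (R := 𝕜).2 n.factorial_ne_zero
  have := n.cast_add_one_ne_zero (R := 𝕜)
  have : (n : 𝕜) + 1 + 1 ≠ 0 := mod_cast (n + 1).succ_ne_zero
  simp only [← add_assoc] at *
  field_simp
  linear_combination -((n + 2) * a ^ (n + 1)) * hK

theorem zfPdfFactor_ode (m : ℕ) {NR : ℕ} (hNR : 0 < NR) (a : 𝕜) :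
    X * d⁄dX 𝕜 (d⁄dX 𝕜 (d⁄dX 𝕜 (zfPdfFactor m NR a))) +
      (C (m + 2 : 𝕜) - X) * d⁄dX 𝕜 (d⁄dX 𝕜 (zfPdfFactor m NR a)) -
      C (NR + a) * d⁄dX 𝕜 (zfPdfFactor m NR a) + C a * zfPdfFactor m NR a = 0 := by
  ext n
  simp only [add_mul, sub_mul, map_add, map_sub, coeff_C_mul, coeff_X_mul_derivative,
    coeff_derivative, map_zero]
  push_cast
  linear_combination coeff_zfPdfFactor_recurrence m hNR a n

theorem exp_mul_zfPdfFactor_ode (m : ℕ) {NR : ℕ} (hNR : 0 < NR) (a : 𝕜) {H : 𝕜⟦X⟧}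
    (hH : H = rescale (-1) (exp 𝕜) * zfPdfFactor m NR a) :
    X * d⁄dX 𝕜 (d⁄dX 𝕜 (d⁄dX 𝕜 H)) + (C (m + 2 : 𝕜) + 2 * X) * d⁄dX 𝕜 (d⁄dX 𝕜 H) +
      (X + C (2 * (m + 2) - (NR + a) : 𝕜)) * d⁄dX 𝕜 H + C (m + 2 - NR : 𝕜) * H = 0 := by
  have hode := zfPdfFactor_ode m hNR a
  have hE : d⁄dX 𝕜 (rescale (-1) (exp 𝕜)) = -rescale (-1) (exp 𝕜) := by
    rw [derivative_rescale, derivative_exp, map_neg, map_one, neg_one_mul]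
  simp only [hH, Derivation.leibniz, hE, smul_eq_mul, map_add, map_sub, map_mul, map_neg,
    map_ofNat] at hode ⊢
  linear_combination rescale (-1) (exp 𝕜) * hode

theorem zfPdfTimeSeries_ode (m : ℕ) {NR : ℕ} (hNR : 0 < NR) (a : 𝕜) :
    X ^ 2 * d⁄dX 𝕜 (d⁄dX 𝕜 (d⁄dX 𝕜 (zfPdfTimeSeries m NR a))) +
      X * (C (2 - 2 * m : 𝕜) + 2 * X) * d⁄dX 𝕜 (d⁄dX 𝕜 (zfPdfTimeSeries m NR a)) +
      (C (m * (m - 1) : 𝕜) + C (4 - 2 * m - NR - a : 𝕜) * X + X ^ 2) *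
        d⁄dX 𝕜 (zfPdfTimeSeries m NR a) +
      (C (m * (NR + a - 2) : 𝕜) + C (2 - NR : 𝕜) * X) * zfPdfTimeSeries m NR a = 0 := by
  have hode := exp_mul_zfPdfFactor_ode m hNR a rfl
  -- Each derivative of `X ^ m` is absorbed by one factor `X`, which leaves a multiple of `hode`.
  have hM₁ := X_mul_derivative_X_pow (R := 𝕜) m
  have hM₂ := X_mul_derivative_derivative hM₁
  have hM₃ := X_mul_derivative_derivative hM₂
  rw [zfPdfTimeSeries]
  set H := rescale (-1) (exp 𝕜) * zfPdfFactor m NR a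
  set M : 𝕜⟦X⟧ := X ^ m
  simp only [Derivation.leibniz, smul_eq_mul, map_add, map_sub, map_mul, map_one, map_ofNat,
    map_natCast] at *
  set H₁ := d⁄dX 𝕜 H
  set H₂ := d⁄dX 𝕜 H₁
  linear_combination X * M * hode + X * H * hM₃ +
    ((m - 2) * H + 3 * X * H₁ + (2 - 2 * m + 2 * X) * H) * hM₂ +
    (3 * (m - 1) * H₁ + 3 * X * H₂ + 2 * (m - 1) * H + 2 * (2 - 2 * m + 2 * X) * H₁ +
      (4 - 2 * m - NR - C a) * H + X * H) * hM₁

theorem isHolonomicFst_zfPdf {N NR : ℕ} (hN : 0 < N) (hNR : 0 < NR) (Γ : 𝕜) :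
    IsHolonomicFst (fun t a : 𝕜 => zfPdf N NR Γ t a) Set.univ := by
  obtain ⟨m, rfl⟩ := Nat.exists_eq_succ_of_ne_zero hN.ne'
  let t : MvPolynomial (Fin 2) 𝕜 := .X 0
  let a : MvPolynomial (Fin 2) 𝕜 := .X 1
  let g : MvPolynomial (Fin 2) 𝕜 := .C Γ⁻¹
  let b : MvPolynomial (Fin 2) 𝕜 := .C (NR : 𝕜)
  refine .of_powerSeries 3 (fun i => match i with
    | 0 => g * (m * (b + a - 2) + (2 - b) * (g * t))
    | 1 => m * (m - 1) + (4 - 2 * m - b - a) * (g * t) + (g * t) ^ 2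
    | 2 => t * (2 - 2 * m + 2 * (g * t))
    | _ => t ^ 2)
    (fun y => C (Γ⁻¹ / m.factorial) * rescale Γ⁻¹ (zfPdfTimeSeries m NR y))
    (fun _ _ _ => ⟨1, by simp [t]⟩)
    (fun _ y _ => mul_mem (C_mem_entireSeries _)
      (rescale_mem_entireSeries (zfPdfTimeSeries_mem_entireSeries m hNR y) _))
    (fun _ y _ x => zfPdf_eq_seriesSum_time m hNR Γ x y)
    (fun _ y _ => ?_)
  have hode := congrArg (rescale Γ⁻¹) (zfPdfTimeSeries_ode m hNR y)
  simp only [Finset.sum_range_succ, Finset.range_zero, Finset.sum_empty, Function.iterate_succ,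
    Function.iterate_zero, Function.comp_apply, id_eq, derivative_C_mul, derivative_rescale]
  simp only [t, a, g, b, map_mul, map_pow, map_add, map_sub, map_one, map_ofNat, map_natCast,
    map_zero, MvPolynomial.aeval_X, MvPolynomial.aeval_C, Matrix.cons_val_zero,
    Matrix.cons_val_one, PowerSeries.algebraMap_apply, Algebra.algebraMap_self_apply,
    rescale_X, rescale_C] at hode ⊢
  linear_combination C (Γ⁻¹ / m.factorial) * C Γ⁻¹ * hode

theorem isHolonomic_zfPdf {N NR : ℕ} (hN : 0 < N) (hNR : 0 < NR) (Γ : 𝕜) :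
    IsHolonomic (fun t a : 𝕜 => zfPdf N NR Γ t a) Set.univ :=
  ⟨isHolonomicFst_zfPdf hN hNR Γ, isHolonomicFst_zfPdf_swap hN hNR Γ⟩

theorem continuous_zfPdf {N NR : ℕ} (hN : 0 < N) (hNR : 0 < NR) (Γ a : 𝕜) :
    Continuous fun t => zfPdf N NR Γ t a := by
  obtain ⟨m, rfl⟩ := Nat.exists_eq_succ_of_ne_zero hN.ne'
  rw [funext fun t => zfPdf_eq_seriesSum_time m hNR Γ t a]
  exact (contDiff_seriesSum (mul_mem (C_mem_entireSeries _)
    (rescale_mem_entireSeries (zfPdfTimeSeries_mem_entireSeries m hNR a) _)) 0).continuous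

end Pdf

/-! ### The law of the zero-forcing SNR -/

section Law

open fwdDiff

theorem integrable_tsum_of_summable_integral_norm {ι α E : Type*} [Countable ι]
    [MeasurableSpace α] [NormedAddCommGroup E] {μ : Measure α} {F : ι → α → E}
    (hF : ∀ n, Integrable (F n) μ)
    (hsum : Summable fun n => ∫ x, ‖F n x‖ ∂μ)
    (hmeas : AEStronglyMeasurable (fun x => ∑' n, F n x) μ) :
    Integrable (fun x => ∑' n, F n x) μ := by
  refine ⟨hmeas, ?_⟩
  calc ∫⁻ x, ‖∑' n, F n x‖ₑ ∂μ ≤ ∫⁻ x, ∑' n, ‖F n x‖ₑ ∂μ :=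
        lintegral_mono fun x => enorm_tsum_le_tsum_enorm
    _ = ∑' n, ∫⁻ x, ‖F n x‖ₑ ∂μ := lintegral_tsum fun n => (hF n).1.enorm
    _ = ∑' n, ENNReal.ofReal (∫ x, ‖F n x‖ ∂μ) :=
        tsum_congr fun n => (ofReal_integral_norm_eq_lintegral_enorm (hF n)).symm
    _ < ⊤ := hsum.tsum_ofReal_lt_top

theorem erlangPdf_nonneg {Γ t : ℝ} (hΓ : 0 < Γ) (ht : 0 ≤ t) (n : ℕ) : 0 ≤ erlangPdf Γ t n := by
  rw [erlangPdf, ← Real.exp_eq_exp_ℝ]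
  positivity

theorem zfPdf_nonneg {N NR : ℕ} (hN : 0 < N) (h : N ≤ NR) {Γ a t : ℝ} (hΓ : 0 < Γ) (ha : 0 ≤ a)
    (ht : 0 ≤ t) : 0 ≤ zfPdf N NR Γ t a := by
  obtain ⟨m, rfl⟩ := Nat.exists_eq_succ_of_ne_zero hN.ne'
  rw [zfPdf_eq_tsum_erlangPdf m (hN.trans_le h)]
  refine tsum_nonneg fun k => mul_nonneg (erlangPdf_nonneg hΓ ht _) (mul_nonneg ?_
    (kummer_neg_nonneg (by lia) (by lia) ha))
  rw [kummerTerm]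
  positivity

variable {Γ s : ℝ}

theorem integral_exp_mul_erlangPdf (hΓ : 0 < Γ) (hs : 0 < 1 - Γ * s) (n : ℕ) :
    ∫ t in Set.Ioi 0, Real.exp (s * t) * erlangPdf Γ t n = (1 / (1 - Γ * s)) ^ (n + 1) := by
  have hgamma := Real.integral_rpow_mul_exp_neg_mul_Ioi (a := (n + 1 : ℕ)) (by positivity)
    (div_pos hs hΓ)
  rw [Real.rpow_natCast, Nat.cast_succ, Real.Gamma_nat_eq_factorial] at hgamma
  have hintegrand : ∀ t, Real.exp (s * t) * erlangPdf Γ t n = (1 / (n.factorial * Γ ^ (n + 1))) *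
      (t ^ ((n + 1 : ℝ) - 1) * Real.exp (-((1 - Γ * s) / Γ * t))) := by
    intro t
    have hexp : Real.exp (-((1 - Γ * s) / Γ * t)) = Real.exp (s * t) * Real.exp (-t / Γ) := by
      rw [← Real.exp_add]
      congr 1
      field_simp
      ring
    rw [hexp, erlangPdf, add_sub_cancel_right, Real.rpow_natCast, ← Real.exp_eq_exp_ℝ]
    ring
  simp only [hintegrand, integral_const_mul, hgamma]
  rw [one_div_div, div_pow, one_div_pow]
  field_simp

theorem integrableOn_exp_mul_erlangPdf (hΓ : 0 < Γ) (hs : 0 < 1 - Γ * s) (n : ℕ) :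
    IntegrableOn (fun t => Real.exp (s * t) * erlangPdf Γ t n) (Set.Ioi 0) := by
  by_contra hint
  have hzero := (integral_undef hint).symm.trans (integral_exp_mul_erlangPdf hΓ hs n)
  have : 0 < (1 / (1 - Γ * s)) ^ (n + 1) := by positivity
  exact this.ne hzero

theorem integrableOn_exp_mul_fwdDiff_erlangPdf (hΓ : 0 < Γ) (hs : 0 < 1 - Γ * s) (n k : ℕ) :
    IntegrableOn (fun t => Real.exp (s * t) * (Δ_[1])^[n] (erlangPdf Γ t) k) (Set.Ioi 0) := by
  induction n generalizing k with
  | zero => exact integrableOn_exp_mul_erlangPdf hΓ hs k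
  | succ n ih =>
    simp only [fwdDiff_iter_succ_apply, mul_sub]
    exact (ih (k + 1)).sub (ih k)

theorem integral_exp_mul_fwdDiff_erlangPdf (hΓ : 0 < Γ) (hs : 0 < 1 - Γ * s) (n k : ℕ) :
    ∫ t in Set.Ioi 0, Real.exp (s * t) * (Δ_[1])^[n] (erlangPdf Γ t) k =
      (1 / (1 - Γ * s)) ^ (k + 1) * (Γ * s / (1 - Γ * s)) ^ n := by
  have hy : Γ * s / (1 - Γ * s) = 1 / (1 - Γ * s) - 1 := by field_simp; ring
  induction n generalizing k with
  | zero => simpa using integral_exp_mul_erlangPdf hΓ hs k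
  | succ n ih =>
    simp only [fwdDiff_iter_succ_apply, mul_sub]
    rw [integral_sub (integrableOn_exp_mul_fwdDiff_erlangPdf hΓ hs n (k + 1))
      (integrableOn_exp_mul_fwdDiff_erlangPdf hΓ hs n k), ih, ih, hy]
    ring

theorem integral_norm_exp_mul_fwdDiff_erlangPdf_le (hΓ : 0 < Γ) (hs : 0 < 1 - Γ * s) (n k : ℕ) :
    ∫ t in Set.Ioi 0, ‖Real.exp (s * t) * (Δ_[1])^[n] (erlangPdf Γ t) k‖ ≤
      (1 / (1 - Γ * s)) ^ (k + 1) * (1 / (1 - Γ * s) + 1) ^ n := by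
  induction n generalizing k with
  | zero =>
    refine (setIntegral_congr_fun measurableSet_Ioi fun t ht => ?_).trans_le
      ((integral_exp_mul_erlangPdf hΓ hs k).trans_le (by simp))
    exact Real.norm_of_nonneg
      (mul_nonneg (Real.exp_nonneg _) (erlangPdf_nonneg hΓ (le_of_lt ht) k))
  | succ n ih =>
    have hint := fun k => (integrableOn_exp_mul_fwdDiff_erlangPdf hΓ hs n k).norm
    calc _ ≤ ∫ t in Set.Ioi 0, (‖Real.exp (s * t) * (Δ_[1])^[n] (erlangPdf Γ t) (k + 1)‖ +
          ‖Real.exp (s * t) * (Δ_[1])^[n] (erlangPdf Γ t) k‖) := by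
          refine integral_mono (integrableOn_exp_mul_fwdDiff_erlangPdf hΓ hs (n + 1) k).norm
            ((hint (k + 1)).add (hint k)) fun t => ?_
          simp only [fwdDiff_iter_succ_apply, mul_sub]
          exact norm_sub_le _ _
      _ ≤ (1 / (1 - Γ * s)) ^ (k + 1 + 1) * (1 / (1 - Γ * s) + 1) ^ n +
          (1 / (1 - Γ * s)) ^ (k + 1) * (1 / (1 - Γ * s) + 1) ^ n := by
          rw [integral_add (hint (k + 1)) (hint k)]
          exact add_le_add (ih (k + 1)) (ih k)
      _ = _ := by ring

theorem summable_integral_norm_exp_mul_zfPdf (m : ℕ) {NR : ℕ} (hNR : 0 < NR) (hΓ : 0 < Γ)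
    (hs : 0 < 1 - Γ * s) (a : ℝ) :
    Summable fun n => ∫ t in Set.Ioi 0, ‖kummerTerm (m + 1) NR n a *
      (Real.exp (s * t) * (Δ_[1])^[n] (erlangPdf Γ t) m)‖ := by
  refine .of_nonneg_of_le (fun n => integral_nonneg fun t => norm_nonneg _) (fun n => ?_)
    ((Real.summable_pow_div_factorial ((m + 1 : ℕ) * ‖a‖ * (1 / (1 - Γ * s) + 1))).mul_left
      ((1 / (1 - Γ * s)) ^ (m + 1)))
  simp only [norm_mul (kummerTerm (m + 1) NR n a), integral_const_mul]
  refine (mul_le_mul (norm_kummerTerm_le (Nat.le_add_left 1 m)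
    (Nat.le_mul_of_pos_right (m + 1) hNR) n a)
    (integral_norm_exp_mul_fwdDiff_erlangPdf_le hΓ hs n m)
    (integral_nonneg fun t => norm_nonneg _) (by positivity)).trans_eq ?_
  rw [mul_pow _ (1 / (1 - Γ * s) + 1)]
  ring

theorem exp_mul_zfPdf_eq_tsum (m NR : ℕ) (Γ s a t : ℝ) :
    Real.exp (s * t) * zfPdf (m + 1) NR Γ t a = ∑' n, kummerTerm (m + 1) NR n a *
      (Real.exp (s * t) * (Δ_[1])^[n] (erlangPdf Γ t) m) := by
  rw [zfPdf_eq_tsum_fwdDiff, ← tsum_mul_left]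
  exact tsum_congr fun n => mul_left_comm _ _ _

theorem integrableOn_exp_mul_zfPdf {N NR : ℕ} (hN : 0 < N) (hNR : 0 < NR) (hΓ : 0 < Γ)
    (hs : 0 < 1 - Γ * s) (a : ℝ) :
    IntegrableOn (fun t => Real.exp (s * t) * zfPdf N NR Γ t a) (Set.Ioi 0) := by
  have hcont : Continuous fun t => Real.exp (s * t) * zfPdf N NR Γ t a :=
    (by fun_prop : Continuous fun t : ℝ => Real.exp (s * t)).mul (continuous_zfPdf hN hNR Γ a)
  have hmeas := hcont.aestronglyMeasurable (μ := volume.restrict (Set.Ioi 0))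
  obtain ⟨m, rfl⟩ := Nat.exists_eq_succ_of_ne_zero hN.ne'
  simp only [Nat.succ_eq_add_one, exp_mul_zfPdf_eq_tsum] at hmeas ⊢
  exact integrable_tsum_of_summable_integral_norm
    (fun n => (integrableOn_exp_mul_fwdDiff_erlangPdf hΓ hs n m).const_mul _)
    (summable_integral_norm_exp_mul_zfPdf m hNR hΓ hs a) hmeas

theorem integral_exp_mul_zfPdf {N NR : ℕ} (hN : 0 < N) (hNR : 0 < NR) (hΓ : 0 < Γ)
    (hs : 0 < 1 - Γ * s) (a : ℝ) :
    ∫ t in Set.Ioi 0, Real.exp (s * t) * zfPdf N NR Γ t a = zfMgf N NR Γ s a := by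
  obtain ⟨m, rfl⟩ := Nat.exists_eq_succ_of_ne_zero hN.ne'
  simp only [Nat.succ_eq_add_one, exp_mul_zfPdf_eq_tsum]
  rw [← integral_tsum_of_summable_integral_norm
    (fun n => (integrableOn_exp_mul_fwdDiff_erlangPdf hΓ hs n m).const_mul _)
    (summable_integral_norm_exp_mul_zfPdf m hNR hΓ hs a), zfMgf, kummer, ← tsum_mul_left]
  refine tsum_congr fun n => ?_
  rw [integral_const_mul, integral_exp_mul_fwdDiff_erlangPdf hΓ hs, kummerTerm, kummerTerm,
    mul_pow a, one_div_pow]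
  ring

theorem zfMgf_zero {𝕜 : Type*} [NontriviallyNormedField 𝕜] (N NR : ℕ) (Γ a : 𝕜) :
    zfMgf N NR Γ 0 a = 1 := by
  rw [zfMgf, kummer, tsum_eq_single 0 fun n hn => by simp [kummerTerm, hn]]
  simp [kummerTerm]

theorem isZfSnrLaw_withDensity {N NR : ℕ} (hN : 0 < N) (h : N ≤ NR) {a : ℝ} (hΓ : 0 < Γ)
    (ha : 0 ≤ a) :
    IsZfSnrLaw N NR Γ a ((volume.restrict (Set.Ioi 0)).withDensity
      (fun t => ENNReal.ofReal (zfPdf N NR Γ t a))) := by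
  have hNR := hN.trans_le h
  have hmeas : Measurable fun t => ENNReal.ofReal (zfPdf N NR Γ t a) :=
    (continuous_zfPdf hN hNR Γ a).measurable.ennreal_ofReal
  have hpos : ∀ t ∈ Set.Ioi (0 : ℝ), 0 ≤ zfPdf N NR Γ t a := fun t ht =>
    zfPdf_nonneg hN h hΓ ha (le_of_lt ht)
  have htop : ∀ᵐ t ∂volume.restrict (Set.Ioi 0), ENNReal.ofReal (zfPdf N NR Γ t a) < ⊤ :=
    ae_of_all _ fun _ => ENNReal.ofReal_lt_top
  have hsmul : ∀ s : ℝ, Set.EqOn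
      (fun t => (ENNReal.ofReal (zfPdf N NR Γ t a)).toReal • Real.exp (s * t))
      (fun t => Real.exp (s * t) * zfPdf N NR Γ t a) (Set.Ioi 0) := fun s t ht => by
    simp only [ENNReal.toReal_ofReal (hpos t ht), smul_eq_mul, mul_comm]
  refine ⟨⟨?_⟩, fun s hs => ?_⟩
  · have hint := integrableOn_exp_mul_zfPdf hN hNR (s := 0) hΓ (by simp) a
    have hone := integral_exp_mul_zfPdf hN hNR (s := 0) hΓ (by simp) a
    simp only [zero_mul, Real.exp_zero, one_mul, zfMgf_zero] at hint hone
    rw [withDensity_apply _ MeasurableSet.univ, setLIntegral_univ,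
      ← ofReal_integral_eq_lintegral_ofReal hint (ae_restrict_of_forall_mem measurableSet_Ioi hpos),
      hone, ENNReal.ofReal_one]
  · have hs' : 0 < 1 - Γ * s := by linarith [(lt_div_iff₀' hΓ).1 hs]
    constructor
    · rw [integrable_withDensity_iff_integrable_smul' hmeas htop]
      exact (integrableOn_exp_mul_zfPdf hN hNR hΓ hs' a).congr_fun (hsmul s).symm measurableSet_Ioi
    · rw [mgf, integral_withDensity_eq_integral_toReal_smul hmeas htop]
      exact (setIntegral_congr_fun measurableSet_Ioi (hsmul s)).trans
        (integral_exp_mul_zfPdf hN hNR hΓ hs' a)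

theorem IsZfSnrLaw.unique {N NR : ℕ} {a : ℝ} (hΓ : 0 < Γ) {μ ν : Measure ℝ}
    (hμ : IsZfSnrLaw N NR Γ a μ) (hν : IsZfSnrLaw N NR Γ a ν) : μ = ν := by
  have := hμ.1
  have := hν.1
  exact measure_eq_of_eqOn_mgf isOpen_Iio (Set.mem_Iio.2 (one_div_pos.2 hΓ)) (convex_Iio _)
    (fun s hs => (hμ.2 s hs).1) (fun s hs => (hν.2 s hs).1)
    fun s hs => (hμ.2 s hs).2.trans (hν.2 s hs).2.symm

end Law

theorem lemma1 {𝕜 : Type*} [RCLike 𝕜] (N NT NR : ℕ) (hNT : 1 ≤ NT) (hNR : NT ≤ NR)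
    (hN : N = NR - NT + 1) (Γ₁ : ℝ) (hΓ₁ : 0 < Γ₁) :
    IsHolonomic (fun s a : 𝕜 => zfMgf N NR (Γ₁ : 𝕜) s a) {q | 1 - (Γ₁ : 𝕜) * q.1 ≠ 0} ∧
    IsHolonomic (fun t a : 𝕜 => zfPdf N NR (Γ₁ : 𝕜) t a) Set.univ ∧
    ∀ a : ℝ, 0 ≤ a →
      (∀ t : ℝ, 0 < t → 0 ≤ zfPdf N NR Γ₁ t a) ∧
      ∀ μ : Measure ℝ, IsZfSnrLaw N NR Γ₁ a μ ↔
        μ = (volume.restrict (Set.Ioi 0)).withDensity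
          (fun t => ENNReal.ofReal (zfPdf N NR Γ₁ t a)) := by
  have hpos : 0 < N := by lia
  have hle : N ≤ NR := by lia
  have hlaw : ∀ a : ℝ, 0 ≤ a → IsZfSnrLaw N NR Γ₁ a _ := fun a =>
    isZfSnrLaw_withDensity hpos hle hΓ₁
  refine ⟨isHolonomic_zfMgf N (hpos.trans_le hle) _,
    isHolonomic_zfPdf hpos (hpos.trans_le hle) _, fun a ha =>
    ⟨fun t ht => zfPdf_nonneg hpos hle hΓ₁ ha ht.le, fun μ => ⟨fun hμ => ?_, ?_⟩⟩⟩
  · exact hμ.unique hΓ₁ (hlaw a ha)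
  · rintro rfl
    exact hlaw a ha
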